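/- **Corollary (Binomial modulations of Legendre–Sun series).** Let $\mathsf H_n=\sum_{j=1}^n\frac1j$ be the harmonic numbers ($\mathsf H_0=0$), let $(-1)!!=1$ and $(2n+1)!!=\frac{(2n+1)!}{2^nn!}$ for $n\in\mathbb Z_{\ge0}$, and for $|t|<1$ define the following (absolutely convergent) Legendre–Sun series: $$\begin{aligned} \mathsf S_{-1/2}(t)&=2\sum_{k\ge1}\tbinom{2k}k^2\left(\tfrac t{2^4}\right)^k(2\mathsf H_{2k}-\mathsf H_k),&\widetilde{\mathsf S}_{-1/2}(t)&=-\sum_{k\ge1}\tbinom{2k}k^2\left(\tfrac t{2^4}\right)^k\mathsf H_k,\\ \mathsf S_{-1/3}(t)&=\sum_{k\ge1}\tbinom{2k}k\tbinom{3k}k\left(\tfrac t{3^3}\right)^k(3\mathsf H_{3k}-\mathsf H_k),&\widetilde{\mathsf S}_{-1/3}(t)&=-\sum_{k\ge1}\tbinom{2k}k\tbinom{3k}k\left(\tfrac t{3^3}\right)^k\mathsf H_k,\\ \mathsf S_{-1/4}(t)&=2\sum_{k\ge1}\tbinom{2k}k\tbinom{4k}{2k}\left(\tfrac t{2^6}\right)^k(2\mathsf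 H_{4k}-\mathsf H_{2k}),&\widetilde{\mathsf S}_{-1/4}(t)&=-\sum_{k\ge1}\tbinom{2k}k\tbinom{4k}{2k}\left(\tfrac t{2^6}\right)^k\mathsf H_k,\\ \mathsf S_{-1/6}(t)&=\sum_{k\ge1}\tbinom{3k}k\tbinom{6k}{3k}\left(\tfrac t{2^43^3}\right)^k(6\mathsf H_{6k}-3\mathsf H_{3k}-2\mathsf H_{2k}+\mathsf H_k),&\widetilde{\mathsf S}_{-1/6}(t)&=-\sum_{k\ge1}\tbinom{3k}k\tbinom{6k}{3k}\left(\tfrac t{2^43^3}\right)^k\mathsf H_k. \end{aligned}$$ All integrals and series below converge (absolutely). (a) We have $$\begin{aligned} \int_0^1\frac{\mathsf S_{-1/2}(t)}{\sqrt{1-t}}\,dt&=4\sum_{k=0}^\infty\frac{\binom{2k}k}{2^{2k}}\frac{2\mathsf H_{2k}-\mathsf H_k}{2k+1}=4\pi\log2,\\ \int_0^1\frac{\mathsf S_{-1/3}(t)}{\sqrt{1-t}}\,dt&=2\sum_{k=0}^\infty\frac{2^{2k}\binom{3k}k}{3^{3k}}\frac{3\mathsf H_{3k}-\mathsf H_k}{2k+1}=9(2-\log3),\\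 \int_0^1\frac{\mathsf S_{-1/4}(t)}{\sqrt{1-t}}\,dt&=4\sum_{k=0}^\infty\frac{\binom{4k}{2k}}{2^{4k}}\frac{2\mathsf H_{4k}-\mathsf H_{2k}}{2k+1}=4\sqrt2(2-\log2),\\ \int_0^1\frac{\mathsf S_{-1/6}(t)}{\sqrt{1-t}}\,dt&=2\sum_{k=0}^\infty\frac{\binom{3k}k\binom{6k}{3k}}{(2^23^3)^k\binom{2k}k}\frac{6\mathsf H_{6k}-3\mathsf H_{3k}-2\mathsf H_{2k}+\mathsf H_k}{2k+1}=\frac{3\sqrt3}2\left(3+\log\frac{2^4}{3^3}\right). \end{aligned}$$ More generally, put $A_{m,k}=\frac{(2k-1)!!(2m-1)!!}{(2k+2m+1)!!}$. For all $m\in\mathbb Z_{\ge0}$, $$\begin{aligned} \int_0^1\frac{\mathsf S_{-1/2}(t)}{(1-t)^{\frac12-m}}\,dt&=4\sum_{k=0}^\infty\frac{\binom{2k}k}{2^{2k}}(2\mathsf H_{2k}-\mathsf H_k)A_{m,k}\in\mathbb Q\pi+\mathbb Q\pi\log2,\\ \int_0^1\frac{\mathsf S_{-1/3}(t)}{(1-t)^{\frac12-m}}\,dt&=2\sum_{k=0}^\infty\frac{2^{2k}\binom{3k}k}{3^{3k}}(3\mathsf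 H_{3k}-\mathsf H_k)A_{m,k}\in\mathbb Q+\mathbb Q\log3,\\ \int_0^1\frac{\mathsf S_{-1/4}(t)}{(1-t)^{\frac12-m}}\,dt&=4\sum_{k=0}^\infty\frac{\binom{4k}{2k}}{2^{4k}}(2\mathsf H_{4k}-\mathsf H_{2k})A_{m,k}\in\mathbb Q\sqrt2+\mathbb Q\sqrt2\log2,\\ \int_0^1\frac{\mathsf S_{-1/6}(t)}{(1-t)^{\frac12-m}}\,dt&=2\sum_{k=0}^\infty\frac{\binom{6k}{3k}\binom{3k}k}{(2^23^3)^k\binom{2k}k}(6\mathsf H_{6k}-3\mathsf H_{3k}-2\mathsf H_{2k}+\mathsf H_k)A_{m,k}\in\mathbb Q\sqrt3+\mathbb Q\sqrt3\log\frac{2^4}{3^3}. \end{aligned}$$ (b) We have $$\begin{aligned} \int_0^1\frac{\mathsf S_{-1/2}(t)+\widetilde{\mathsf S}_{-1/2}(t)}{\pi\sqrt{t(1-t)}}\,dt&=\sum_{k=0}^\infty\frac{\binom{2k}k^3}{2^{6k}}(4\mathsf H_{2k}-3\mathsf H_k)=\frac{\Gamma(\frac14)^4}{2\pi^3}\log2,\\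 \int_0^1\frac{\mathsf S_{-1/3}(t)+\widetilde{\mathsf S}_{-1/3}(t)}{\pi\sqrt{t(1-t)}}\,dt&=\sum_{k=0}^\infty\frac{\binom{2k}k^2\binom{3k}k}{2^{2k}3^{3k}}(3\mathsf H_{3k}-2\mathsf H_k)=\frac{9\sqrt[3]2\,\Gamma(\frac13)^6}{16\pi^4}\log2,\\ \int_0^1\frac{\mathsf S_{-1/4}(t)+\widetilde{\mathsf S}_{-1/4}(t)}{\pi\sqrt{t(1-t)}}\,dt&=\sum_{k=0}^\infty\frac{\binom{2k}k^2\binom{4k}{2k}}{2^{8k}}(4\mathsf H_{4k}-2\mathsf H_{2k}-\mathsf H_k)=\frac{2\pi\log2}{[\Gamma(\frac58)\Gamma(\frac78)]^2},\\ \int_0^1\frac{\mathsf S_{-1/6}(t)+\widetilde{\mathsf S}_{-1/6}(t)}{\pi\sqrt{t(1-t)}}\,dt&=\sum_{k=0}^\infty\frac{\binom{2k}k\binom{3k}k\binom{6k}{3k}}{2^{6k}3^{3k}}(6\mathsf H_{6k}-3\mathsf H_{3k}-2\mathsf H_{2k})=\frac{2\pi\log2}{[\Gamma(\frac7{12})\Gamma(\frac{11}{12})]^2}.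 \end{aligned}$$ More generally, put $B_{m,k}=\frac{(2k+2m-1)!!}{\binom{k+2m}k(2k-1)!!\,m!}$. For all $m\in\mathbb Z_{\ge0}$, $$\begin{aligned} \int_0^1\frac{\mathsf S_{-1/2}(t)+\widetilde{\mathsf S}_{-1/2}(t)}{\pi[t(1-t)]^{\frac12-m}}\,dt&=\sum_{k=0}^\infty\frac{\binom{2k}k^3}{2^{6k+3m}}(4\mathsf H_{2k}-3\mathsf H_k)B_{m,k}\in\mathbb Q\frac{\Gamma(\frac14)^4}{\pi^3}+\mathbb Q\frac{\Gamma(\frac14)^4}{\pi^3}\log2,\\ \int_0^1\frac{\mathsf S_{-1/3}(t)+\widetilde{\mathsf S}_{-1/3}(t)}{\pi[t(1-t)]^{\frac12-m}}\,dt&=\sum_{k=0}^\infty\frac{\binom{2k}k^2\binom{3k}k}{2^{2k+3m}3^{3k}}(3\mathsf H_{3k}-2\mathsf H_k)B_{m,k}\in\mathbb Q\frac{\sqrt[3]2\,\Gamma(\frac13)^6}{\pi^4}+\mathbb Q\frac{\sqrt[3]2\,\Gamma(\frac13)^6}{\pi^4}\log2,\\ \int_0^1\frac{\mathsf S_{-1/4}(t)+\widetilde{\mathsf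 S}_{-1/4}(t)}{\pi[t(1-t)]^{\frac12-m}}\,dt&=\sum_{k=0}^\infty\frac{\binom{2k}k^2\binom{4k}{2k}}{2^{8k+3m}}(4\mathsf H_{4k}-2\mathsf H_{2k}-\mathsf H_k)B_{m,k}\in\mathbb Q\frac{\pi}{[\Gamma(\frac58)\Gamma(\frac78)]^2}+\mathbb Q\frac{\pi\log2}{[\Gamma(\frac58)\Gamma(\frac78)]^2},\\ \int_0^1\frac{\mathsf S_{-1/6}(t)+\widetilde{\mathsf S}_{-1/6}(t)}{\pi[t(1-t)]^{\frac12-m}}\,dt&=\sum_{k=0}^\infty\frac{\binom{2k}k\binom{3k}k\binom{6k}{3k}}{2^{6k+3m}3^{3k}}(6\mathsf H_{6k}-3\mathsf H_{3k}-2\mathsf H_{2k})B_{m,k}\in\mathbb Q\frac{\pi}{[\Gamma(\frac7{12})\Gamma(\frac{11}{12})]^2}+\mathbb Q\frac{\pi\log2}{[\Gamma(\frac7{12})\Gamma(\frac{11}{12})]^2}. \end{aligned}$$ In each of these eight families, the two rational coefficients can be chosen as computable functions of $m$. -/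

import Mathlib

open scoped Nat

noncomputable section

/-- The harmonic number `H_n = ∑_{k=1}^n 1/k`, as a real number. -/
def harm (n : ℕ) : ℝ := (harmonic n : ℝ)

/-! Summands of the Legendre-Sun series. The series run over `k ≥ 1`; since `H_0 = 0`, the summand
at `k = 0` vanishes and we let `k` run over all of `ℕ`. -/

/-- Summand of the Legendre-Sun series of degree `-1/2`. -/
def lsTerm2 (t : ℝ) (k : ℕ) : ℝ :=
  2 * (((2 * k).choose k : ℝ) ^ 2 * (t / 2 ^ 4) ^ k * (2 * harm (2 * k) - harm k))

/-- Summand of the Legendre-Sun series of degree `-1/3`. -/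
def lsTerm3 (t : ℝ) (k : ℕ) : ℝ :=
  ((2 * k).choose k : ℝ) * ((3 * k).choose k : ℝ) * (t / 3 ^ 3) ^ k *
    (3 * harm (3 * k) - harm k)

/-- Summand of the Legendre-Sun series of degree `-1/4`. -/
def lsTerm4 (t : ℝ) (k : ℕ) : ℝ :=
  2 * (((2 * k).choose k : ℝ) * ((4 * k).choose (2 * k) : ℝ) * (t / 2 ^ 6) ^ k *
    (2 * harm (4 * k) - harm (2 * k)))

/-- Summand of the Legendre-Sun series of degree `-1/6`. -/
def lsTerm6 (t : ℝ) (k : ℕ) : ℝ :=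
  ((3 * k).choose k : ℝ) * ((6 * k).choose (3 * k) : ℝ) * (t / (2 ^ 4 * 3 ^ 3)) ^ k *
    (6 * harm (6 * k) - 3 * harm (3 * k) - 2 * harm (2 * k) + harm k)

/-- Summand of the companion Legendre-Sun series of degree `-1/2`. -/
def lsTildeTerm2 (t : ℝ) (k : ℕ) : ℝ :=
  -(((2 * k).choose k : ℝ) ^ 2 * (t / 2 ^ 4) ^ k * harm k)

/-- Summand of the companion Legendre-Sun series of degree `-1/3`. -/
def lsTildeTerm3 (t : ℝ) (k : ℕ) : ℝ :=
  -(((2 * k).choose k : ℝ) * ((3 * k).choose k : ℝ) * (t / 3 ^ 3) ^ k * harm k)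

/-- Summand of the companion Legendre-Sun series of degree `-1/4`. -/
def lsTildeTerm4 (t : ℝ) (k : ℕ) : ℝ :=
  -(((2 * k).choose k : ℝ) * ((4 * k).choose (2 * k) : ℝ) * (t / 2 ^ 6) ^ k * harm k)

/-- Summand of the companion Legendre-Sun series of degree `-1/6`. -/
def lsTildeTerm6 (t : ℝ) (k : ℕ) : ℝ :=
  -(((3 * k).choose k : ℝ) * ((6 * k).choose (3 * k) : ℝ) * (t / (2 ^ 4 * 3 ^ 3)) ^ k * harm k)

/-- The Legendre-Sun series `S_{-1/2}(t)`. -/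
def ls2 (t : ℝ) : ℝ := ∑' k, lsTerm2 t k
/-- The Legendre-Sun series `S_{-1/3}(t)`. -/
def ls3 (t : ℝ) : ℝ := ∑' k, lsTerm3 t k
/-- The Legendre-Sun series `S_{-1/4}(t)`. -/
def ls4 (t : ℝ) : ℝ := ∑' k, lsTerm4 t k
/-- The Legendre-Sun series `S_{-1/6}(t)`. -/
def ls6 (t : ℝ) : ℝ := ∑' k, lsTerm6 t k
/-- The companion Legendre-Sun series of degree `-1/2`. -/
def lsTilde2 (t : ℝ) : ℝ := ∑' k, lsTildeTerm2 t k
/-- The companion Legendre-Sun series of degree `-1/3`. -/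
def lsTilde3 (t : ℝ) : ℝ := ∑' k, lsTildeTerm3 t k
/-- The companion Legendre-Sun series of degree `-1/4`. -/
def lsTilde4 (t : ℝ) : ℝ := ∑' k, lsTildeTerm4 t k
/-- The companion Legendre-Sun series of degree `-1/6`. -/
def lsTilde6 (t : ℝ) : ℝ := ∑' k, lsTildeTerm6 t k

/-- The chain of equalities `∫₀¹ f(t) dt = ∑_{k ≥ 0} u k = v`, where the integral converges
absolutely and the series converges. -/
def IntegralEqSeriesEq (f : ℝ → ℝ) (u : ℕ → ℝ) (v : ℝ) : Prop :=
  IntervalIntegrable f MeasureTheory.volume 0 1 ∧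
    (∫ t in (0 : ℝ)..1, f t) = v ∧ HasSum u v

/-- A computable sequence of rational numbers: numerators (written as a difference of two natural
numbers) and denominators are given by (total) recursive functions. -/
def ComputableRatSeq (c : ℕ → ℚ) : Prop :=
  ∃ p q d : ℕ → ℕ, Computable p ∧ Computable q ∧ Computable d ∧
    ∀ m, d m ≠ 0 ∧ c m = ((p m : ℚ) - (q m : ℚ)) / (d m : ℚ)

/-- For every `m`, the integral of `f m` over `[0,1]` equals the sum of the series `u m`, and the
common value lies in `ℚ x + ℚ y`, with coefficients that are computable from `m`. -/
def FamilyInRatSpan (f : ℕ → ℝ → ℝ) (u : ℕ → ℕ → ℝ) (x y : ℝ) : Prop :=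
  ∃ a b : ℕ → ℚ, ComputableRatSeq a ∧ ComputableRatSeq b ∧
    ∀ m, IntegralEqSeriesEq (f m) (u m) ((a m : ℝ) * x + (b m : ℝ) * y)

/-- The quotient `(2k-1)!! (2m-1)!! / (2k+2m+1)!!`. Truncated subtraction gives `0‼ = 1` for the
double factorial of `-1`, as it should be. -/
def dfRatioA (m k : ℕ) : ℝ :=
  ((2 * k - 1)‼ : ℝ) * ((2 * m - 1)‼ : ℝ) / ((2 * k + 2 * m + 1)‼ : ℝ)

/-- The quotient `(2k+2m-1)!! / (binom(k+2m,k) (2k-1)!! m!)`, with `(-1)!! = 1` as above. -/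
def dfRatioB (m k : ℕ) : ℝ :=
  ((2 * k + 2 * m - 1)‼ : ℝ) / (((k + 2 * m).choose k : ℝ) * ((2 * k - 1)‼ : ℝ) * (m ! : ℝ))

end

/-! Write b = 1 - a with a = 1/2, 1/3, 1/4, 1/6. The normalised binomial products are (a)_k (b)_k /
k!², and the harmonic combinations multiplying them are logarithmic derivatives of rising
factorials. Hence S is the derivative at x = 0 of ₂F₁(a+x, b+x; 1; t), and S plus its companion is
the derivative at x = 0 of ₂F₁(a+x, b+x; 1+x; t).

Integrating t^k against a beta density gives a beta value, that is, a constant times a quotient of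
rising factorials. With q = 1/2 + m, the density (1-t)^(q-1) turns the first series into ₂F₁(a+x,
b+x; 1+q; 1), summed by Gauss' theorem (`tsum_hypCoeff`). The density (t(1-t))^(q-1) turns the
second into ₃F₂(a+x, b+x, q; 1+x, 2q; 1). This is exactly Watson's shape, because 1+x is half of
(a+x)+(b+x)+1; so `tsum_watsonTerm` applies, and this is why the companion series is added.
Differentiating the closed forms at x = 0 gives a Gamma quotient times a digamma combination
(`hasSum_lsCoeff_zero`, `hasSum_lsCoeff_one`). Nonnegativity of the coefficients justifies termwise
integration (`integral_powerSeries_mul_beta`).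

Both summation theorems come from one principle: the sum and its conjectured closed form obey the
same first-order recurrence under a unit shift of a parameter c, proved by telescoping, and their
ratio is fixed by the behaviour as c tends to infinity. For Gauss the limit is 1. For Watson it is a
₂F₁ at 1/2, which is evaluated by specialising c to a/2, where the Watson series collapses to a
Gauss series.

The dependence on m is elementary: Gamma and digamma at arguments shifted by m differ from their
values at m = 0 by rational products and rational sums, which are computable. The values at m = 0
come from the reflection and duplication formulas for Gamma and from the limit of log n - ∑ 1/(x+i)
for digamma. In (b) the parameter-dependent digamma values cancel at m = 0, leaving ψ(1) - ψ(1/2) =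
2 log 2 in all four cases. -/

section

open Filter Topology Asymptotics Finset

/-! ### Rising factorials and Gamma asymptotics -/

/-- The rising factorial `x (x + 1) ⋯ (x + k - 1)`. -/
noncomputable def poch (x : ℝ) (k : ℕ) : ℝ := ∏ i ∈ range k, (x + i)

@[simp] theorem poch_zero (x : ℝ) : poch x 0 = 1 := by simp [poch]

theorem poch_succ (x : ℝ) (k : ℕ) : poch x (k + 1) = poch x k * (x + k) := by
  simp [poch, prod_range_succ]

theorem poch_pos {x : ℝ} (hx : 0 < x) (k : ℕ) : 0 < poch x k :=
  prod_pos fun i _ => by positivity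

theorem poch_one (k : ℕ) : poch 1 k = k ! := by
  induction k with
  | zero => simp
  | succ k ih => rw [poch_succ, ih, Nat.factorial_succ]; push_cast; ring

theorem mul_poch_add_one (x : ℝ) (k : ℕ) : x * poch (x + 1) k = (x + k) * poch x k := by
  induction k with
  | zero => simp
  | succ k ih => rw [poch_succ, poch_succ, ← mul_assoc, ih]; push_cast; ring

theorem Gamma_add_natCast {x : ℝ} (hx : 0 < x) (k : ℕ) :
    Real.Gamma (x + k) = poch x k * Real.Gamma x := by
  induction k with
  | zero => simp
  | succ k ih =>
    rw [Nat.cast_succ, ← add_assoc, Real.Gamma_add_one (by positivity), ih, poch_succ]; ring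

theorem poch_le_poch {x y : ℝ} (hx : 0 < x) (hxy : x ≤ y) (k : ℕ) : poch x k ≤ poch y k :=
  prod_le_prod (fun i _ => by positivity) fun i _ => by linarith

/-- Euler's limit formula for Gamma, inverted: `GammaSeq` has one more factor x + n in its
denominator, which the quotient n/(n + x) compensates. -/
theorem tendsto_Gamma_ratio {x : ℝ} (hx : 0 < x) :
    Tendsto (fun n : ℕ => Real.Gamma (x + n) / (n ! * (n : ℝ) ^ (x - 1))) atTop (𝓝 1) := by
  have h1 := Real.GammaSeq_tendsto_Gamma x
  have hG := (Real.Gamma_pos_of_pos hx).ne'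
  have h2 : Tendsto (fun n : ℕ => (n : ℝ) / (n + x)) atTop (𝓝 1) :=
    tendsto_natCast_div_add_atTop x
  have h3 := (tendsto_const_nhds (x := Real.Gamma x)).mul (h2.mul (h1.inv₀ hG))
  rw [one_mul, mul_inv_cancel₀ hG] at h3
  refine h3.congr' ?_
  filter_upwards [eventually_gt_atTop 0] with n hn
  have hn' : (0 : ℝ) < n := by exact_mod_cast hn
  have hp := poch_pos hx n
  rw [Gamma_add_natCast hx, Real.GammaSeq, show ∏ j ∈ range (n + 1), (x + (j : ℝ)) =
    poch x n * (x + n) from poch_succ x n, Real.rpow_sub_one hn'.ne']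
  have : (0 : ℝ) < (n : ℝ) ^ x := by positivity
  have : (0 : ℝ) < x + n := by positivity
  field_simp
  ring

theorem isTheta_poch {x : ℝ} (hx : 0 < x) :
    (fun k => poch x k) =Θ[atTop] fun k : ℕ => (k ! : ℝ) * (k : ℝ) ^ (x - 1) := by
  have hG := (Real.Gamma_pos_of_pos hx).ne'
  have h := (tendsto_Gamma_ratio hx).div_const (Real.Gamma x)
  refine (isTheta_of_div_tendsto_nhds_ne_zero (c := 1 / Real.Gamma x) ?_ (by positivity)).symm
  refine h.congr fun n => ?_
  rw [Gamma_add_natCast hx]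
  field_simp

/-- For positive shifts with equal sums, quotients of Gamma values tend to one. -/
theorem tendsto_Gamma_quotient {x y z w : ℝ} (hx : 0 < x) (hy : 0 < y) (hz : 0 < z) (hw : 0 < w)
    (h : x + y = z + w) :
    Tendsto (fun n : ℕ => Real.Gamma (x + n) * Real.Gamma (y + n) /
      (Real.Gamma (z + n) * Real.Gamma (w + n))) atTop (𝓝 1) := by
  have h3 := ((tendsto_Gamma_ratio hx).mul (tendsto_Gamma_ratio hy)).div
    ((tendsto_Gamma_ratio hz).mul (tendsto_Gamma_ratio hw)) (by norm_num)
  rw [one_mul, div_one] at h3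
  refine h3.congr' ?_
  filter_upwards [eventually_gt_atTop 0] with n hn
  have hn' : (0 : ℝ) < n := by exact_mod_cast hn
  have e : (n : ℝ) ^ (x - 1) * (n : ℝ) ^ (y - 1) = (n : ℝ) ^ (z - 1) * (n : ℝ) ^ (w - 1) := by
    rw [← Real.rpow_add hn', ← Real.rpow_add hn']; congr 1; linarith
  have p1 : (0 : ℝ) < (n : ℝ) ^ (x - 1) := by positivity
  have p2 : (0 : ℝ) < (n : ℝ) ^ (y - 1) := by positivity
  have p3 : (0 : ℝ) < (n : ℝ) ^ (z - 1) := by positivity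
  have p4 : (0 : ℝ) < (n : ℝ) ^ (w - 1) := by positivity
  have g1 := Real.Gamma_pos_of_pos (show 0 < z + n by positivity)
  have g2 := Real.Gamma_pos_of_pos (show 0 < w + n by positivity)
  have p5 : (0 : ℝ) < n ! := by positivity
  simp only [Pi.div_apply]
  rw [div_mul_div_comm, div_mul_div_comm, div_div_div_eq, div_eq_div_iff (by positivity)
    (by positivity)]
  linear_combination (Real.Gamma (x + n) * Real.Gamma (y + n) * (Real.Gamma (z + n) *
    Real.Gamma (w + n)) * n ! * n !) * (-e)

/-! ### Hypergeometric coefficients and their growth -/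

/-- The coefficients of the hypergeometric series `₂F₁(a, b; c; ·)`. -/
noncomputable def hypCoeff (a b c : ℝ) (k : ℕ) : ℝ := poch a k * poch b k / (poch c k * k !)

theorem hypCoeff_pos {a b c : ℝ} (ha : 0 < a) (hb : 0 < b) (hc : 0 < c) (k : ℕ) :
    0 < hypCoeff a b c k := by
  have := poch_pos ha k; have := poch_pos hb k; have := poch_pos hc k
  unfold hypCoeff; positivity

theorem hypCoeff_succ {a b c : ℝ} (hc : 0 < c) (k : ℕ) :
    (k + 1) * (c + k) * hypCoeff a b c (k + 1) = (a + k) * (b + k) * hypCoeff a b c k := by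
  have := poch_pos hc k
  have : 0 < c + k := by positivity
  simp only [hypCoeff, poch_succ, Nat.factorial_succ]
  push_cast
  field_simp

theorem isTheta_hypCoeff {a b c : ℝ} (ha : 0 < a) (hb : 0 < b) (hc : 0 < c) :
    hypCoeff a b c =Θ[atTop] fun k : ℕ => (k : ℝ) ^ (a + b - c - 1) := by
  have h := ((isTheta_poch ha).mul (isTheta_poch hb)).div
    ((isTheta_poch hc).mul (isTheta_refl (fun k : ℕ => (k ! : ℝ)) atTop))
  refine h.trans_eventuallyEq ?_
  filter_upwards [eventually_gt_atTop 0] with n hn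
  have hn' : (0 : ℝ) < n := by exact_mod_cast hn
  rw [show a + b - c - 1 = (a - 1) + (b - 1) - (c - 1) by ring,
    Real.rpow_sub hn' (a - 1 + (b - 1)), Real.rpow_add hn' (a - 1)]
  have : (0 : ℝ) < (n : ℝ) ^ (c - 1) := by positivity
  have : (0 : ℝ) < n ! := by positivity
  field_simp

theorem isTheta_poch_div_poch {x y : ℝ} (hx : 0 < x) (hy : 0 < y) :
    (fun k => poch x k / poch y k) =Θ[atTop] fun k : ℕ => (k : ℝ) ^ (x - y) := by
  refine ((isTheta_poch hx).div (isTheta_poch hy)).trans_eventuallyEq ?_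
  filter_upwards [eventually_gt_atTop 0] with n hn
  have hn' : (0 : ℝ) < n := by exact_mod_cast hn
  rw [show x - y = (x - 1) - (y - 1) by ring, Real.rpow_sub hn' (x - 1)]
  have : (0 : ℝ) < n ! := by positivity
  field_simp

theorem summable_of_isBigO_rpow {f : ℕ → ℝ} {p : ℝ} (hp : p < -1)
    (h : f =O[atTop] fun k : ℕ => (k : ℝ) ^ p) : Summable f :=
  summable_of_isBigO_nat (Real.summable_nat_rpow.2 hp) h

theorem tendsto_natCast_mul_of_isBigO_rpow {f : ℕ → ℝ} {p : ℝ} (hp : p < -1)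
    (h : f =O[atTop] fun k : ℕ => (k : ℝ) ^ p) :
    Tendsto (fun k : ℕ => (k : ℝ) * f k) atTop (𝓝 0) := by
  have h1 : (fun k : ℕ => (k : ℝ) * f k) =O[atTop] fun k : ℕ => (k : ℝ) ^ (p + 1) := by
    refine ((isBigO_refl (fun k : ℕ => (k : ℝ)) atTop).mul h).trans_eventuallyEq ?_
    filter_upwards [eventually_gt_atTop 0] with n hn
    have hn' : (0 : ℝ) < n := by exact_mod_cast hn
    rw [Real.rpow_add_one hn'.ne', mul_comm]
  refine h1.trans_tendsto ?_
  have := (tendsto_rpow_neg_atTop (show 0 < -(p + 1) by linarith)).comp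
    (tendsto_natCast_atTop_atTop (R := ℝ))
  simpa [Function.comp_def] using this

/-! ### Telescoping, recurrences and Gauss' theorem -/

/-- Telescoping: if `X u - Y v` is a difference of a null sequence vanishing at `0`, the sums
satisfy `X ∑ u = Y ∑ v`. -/
theorem tsum_eq_of_telescoping {u v G : ℕ → ℝ} {X Y : ℝ} (hu : Summable u) (hv : Summable v)
    (h : ∀ k, X * u k - Y * v k = G k - G (k + 1)) (h0 : G 0 = 0) (hG : Tendsto G atTop (𝓝 0)) :
    X * ∑' k, u k = Y * ∑' k, v k := by
  have h1 := ((hu.hasSum.mul_left X).sub (hv.hasSum.mul_left Y)).tendsto_sum_nat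
  have h2 : (fun n => ∑ i ∈ range n, (X * u i - Y * v i)) = fun n => - G n := by
    funext n
    rw [sum_congr rfl fun i _ => h i, sum_range_sub', h0, zero_sub]
  rw [h2] at h1
  have := tendsto_nhds_unique h1 hG.neg
  linarith

/-- A sequence with the same first-order recurrence as a nonvanishing one and the same limit at
infinity agrees with it. -/
theorem eq_of_recurrence_of_tendsto {f g X Y : ℕ → ℝ} {l : ℝ} (hf : ∀ n, X n * f n = Y n * f (n + 1))
    (hg : ∀ n, X n * g n = Y n * g (n + 1)) (hX : ∀ n, X n ≠ 0) (hY : ∀ n, Y n ≠ 0)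
    (hg0 : ∀ n, g n ≠ 0) {l' : ℝ} (hfl : Tendsto f atTop (𝓝 l)) (hgl : Tendsto g atTop (𝓝 l'))
    (hl : l' ≠ 0) : f 0 / g 0 = l / l' := by
  have h : ∀ n, f n / g n = f 0 / g 0 := by
    intro n
    induction n with
    | zero => rfl
    | succ n ih =>
      rw [← ih, div_eq_div_iff (hg0 _) (hg0 _)]
      apply mul_left_cancel₀ (mul_ne_zero (hX n) (hY n))
      linear_combination (-(X n * g n)) * hf n + (X n * f n) * hg n
  refine tendsto_nhds_unique ?_ (hfl.div hgl hl)
  simp only [Pi.div_def, h, tendsto_const_nhds]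

theorem summable_hypCoeff {a b c : ℝ} (ha : 0 < a) (hb : 0 < b) (h : a + b < c) :
    Summable (hypCoeff a b c) :=
  summable_of_isBigO_rpow (by linarith) (isTheta_hypCoeff ha hb (by linarith)).1

theorem hypCoeff_add_one {a b c : ℝ} (hc : 0 < c) (k : ℕ) :
    (c + k) * hypCoeff a b (c + 1) k = c * hypCoeff a b c k := by
  have h1 := poch_pos hc k
  have h2 := poch_pos (show 0 < c + 1 by linarith) k
  have h3 := mul_poch_add_one c k
  have : (0 : ℝ) < k ! := by positivity
  simp only [hypCoeff]
  rw [mul_div_assoc', mul_div_assoc', div_eq_div_iff (by positivity) (by positivity)]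
  linear_combination (-(poch a k * poch b k * k !)) * h3

/-- The contiguous relation in c, certified by a telescoping sequence. Its boundary term k · u k
tends to 0 because u k has order k^(a+b-c-1), with exponent below -1. -/
theorem tsum_hypCoeff_recurrence {a b c : ℝ} (ha : 0 < a) (hb : 0 < b) (h : a + b < c) :
    (c * (c - a - b)) * ∑' k, hypCoeff a b c k =
      ((c - a) * (c - b)) * ∑' k, hypCoeff a b (c + 1) k := by
  have hc : 0 < c := by linarith
  refine tsum_eq_of_telescoping (G := fun k => c * (k * hypCoeff a b c k))
    (summable_hypCoeff ha hb h) (summable_hypCoeff ha hb (by linarith)) ?_ (by simp) ?_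
  · intro k
    have h1 := hypCoeff_succ (a := a) (b := b) hc k
    have h2 := hypCoeff_add_one (a := a) (b := b) hc k
    have : (c + k) ≠ 0 := by positivity
    apply mul_left_cancel₀ this
    push_cast
    linear_combination (-(c - a) * (c - b)) * h2 + c * h1
  · have := tendsto_natCast_mul_of_isBigO_rpow (by linarith) (isTheta_hypCoeff ha hb hc).1
    simpa using this.const_mul c

theorem tendsto_add_div_add_atTop {x y : ℝ} :
    Tendsto (fun n : ℕ => (x + n) / (y + n)) atTop (𝓝 1) := by
  have h1 : Tendsto (fun n : ℕ => 1 + (x - y) / ((n : ℝ) + y)) atTop (𝓝 (1 + 0)) :=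
    (tendsto_const_nhds).add (Tendsto.div_atTop tendsto_const_nhds
      (tendsto_atTop_add_const_right _ _ tendsto_natCast_atTop_atTop))
  rw [add_zero] at h1
  refine h1.congr' ?_
  filter_upwards [tendsto_natCast_atTop_atTop.eventually_gt_atTop (-y)] with n hn
  have : y + n ≠ 0 := by linarith
  rw [add_comm (n : ℝ)]
  field_simp
  ring

/-- As the lower parameter grows, every term with k > 0 dies and the term k = 0 is always 1. The
series at n = 0 is a majorant, since rising factorials increase with their base. -/
theorem tendsto_tsum_hypCoeff {a b c : ℝ} (ha : 0 < a) (hb : 0 < b) (h : a + b < c) :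
    Tendsto (fun n : ℕ => ∑' k, hypCoeff a b (c + n) k) atTop (𝓝 1) := by
  have hc : 0 < c := by linarith
  have key := tendsto_tsum_of_dominated_convergence (𝓕 := atTop)
    (f := fun (n : ℕ) k => hypCoeff a b (c + n) k) (g := fun k => if k = 0 then (1 : ℝ) else 0)
    (summable_hypCoeff ha hb h) ?_ ?_
  · simpa using key
  · intro k
    have hpos (n : ℕ) : 0 < poch (c + n) k := poch_pos (by positivity) k
    split_ifs with hk
    · subst hk; simp [hypCoeff]
    · obtain ⟨j, rfl⟩ := Nat.exists_eq_succ_of_ne_zero hk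
      have h0 : Tendsto (fun n : ℕ => poch a (j+1) * poch b (j+1) / (j+1)! / poch (c + n) (j+1))
          atTop (𝓝 0) := by
        refine Tendsto.div_atTop tendsto_const_nhds ?_
        unfold poch
        simp only [prod_range_succ']
        -- One factor c + n already forces divergence; the other factors are bounded below by their
        -- values at n = 0.
        refine tendsto_atTop_mono (f := fun n : ℕ => (c + n) * (∏ k ∈ range j, (c + ((k + 1 : ℕ) : ℝ)))) ?_ ?_
        · intro n
          have : (∏ k ∈ range j, (c + ((k + 1 : ℕ) : ℝ))) ≤ ∏ k ∈ range j, (c + n + ((k + 1 : ℕ) : ℝ)) :=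
            prod_le_prod (fun i _ => by positivity) fun i _ => by
              have : (0 : ℝ) ≤ n := by positivity
              linarith
          have h2 : 0 ≤ c + n := by positivity
          simp only [Nat.cast_zero, add_zero]
          rw [mul_comm]
          gcongr
        · refine Tendsto.atTop_mul_const (prod_pos fun i _ => by positivity) ?_
          exact tendsto_atTop_add_const_left _ _ tendsto_natCast_atTop_atTop
      refine h0.congr fun n => ?_
      have := (hpos n).ne'
      simp only [hypCoeff]
      field_simp
  · refine Eventually.of_forall fun n k => ?_
    rw [Real.norm_of_nonneg (hypCoeff_pos ha hb (by positivity) k).le]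
    have := poch_pos hc k
    have := poch_pos ha k
    have := poch_pos hb k
    have := poch_le_poch hc (show c ≤ c + n by simp) k
    unfold hypCoeff
    gcongr

/-- **Gauss' summation theorem**. -/
theorem tsum_hypCoeff {a b c : ℝ} (ha : 0 < a) (hb : 0 < b) (h : a + b < c) :
    ∑' k, hypCoeff a b c k =
      Real.Gamma c * Real.Gamma (c - a - b) / (Real.Gamma (c - a) * Real.Gamma (c - b)) := by
  have hc : 0 < c := by linarith
  have h1 : 0 < c - a := by linarith
  have h2 : 0 < c - b := by linarith
  have h3 : 0 < c - a - b := by linarith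
  have g0 {x : ℝ} (hx : 0 < x) (n : ℕ) : Real.Gamma (x + n) ≠ 0 :=
    (Real.Gamma_pos_of_pos (by positivity)).ne'
  have key := eq_of_recurrence_of_tendsto (f := fun n : ℕ => ∑' k, hypCoeff a b (c + n) k)
    (g := fun n : ℕ => Real.Gamma (c + n) * Real.Gamma (c - a - b + n) /
      (Real.Gamma (c - a + n) * Real.Gamma (c - b + n)))
    (X := fun n : ℕ => (c + n) * (c - a - b + n)) (Y := fun n : ℕ => (c - a + n) * (c - b + n))
    (l := 1) (l' := 1) ?_ ?_ (fun n => by positivity) (fun n => by positivity)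
    (fun n => div_ne_zero (mul_ne_zero (g0 hc _) (g0 h3 _)) (mul_ne_zero (g0 h1 _) (g0 h2 _)))
    (tendsto_tsum_hypCoeff ha hb h) (tendsto_Gamma_quotient hc h3 h1 h2 (by ring)) one_ne_zero
  · have e := (div_eq_one_iff_eq (by
      exact div_ne_zero (mul_ne_zero (g0 hc _) (g0 h3 _)) (mul_ne_zero (g0 h1 _) (g0 h2 _)))).1
      (key.trans (div_one 1))
    simpa using e
  · intro n
    have := tsum_hypCoeff_recurrence ha hb (show a + b < c + n by
      have : (0 : ℝ) ≤ n := by positivity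
      linarith)
    push_cast
    rw [← add_assoc]
    convert this using 2 <;> ring
  · intro n
    have s {x : ℝ} (hx : 0 < x) : Real.Gamma (x + (n + 1 : ℕ)) = (x + n) * Real.Gamma (x + n) := by
      push_cast
      rw [← add_assoc, Real.Gamma_add_one (by positivity)]
    rw [s hc, s h1, s h2, s h3]
    have := g0 h1 n
    have := g0 h2 n
    have : 0 < c - a + n := by positivity
    have : 0 < c - b + n := by positivity
    field_simp

/-! ### Watson's theorem and Gauss' second theorem -/

/-- The coefficients of the Watson series `₃F₂(a, b, c; (a + b + 1) / 2, 2c; 1)`. -/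
noncomputable def watsonTerm (a b c : ℝ) (k : ℕ) : ℝ :=
  hypCoeff a b ((a + b + 1) / 2) k * (poch c k / poch (2 * c) k)

theorem watsonTerm_pos {a b c : ℝ} (ha : 0 < a) (hb : 0 < b) (hc : 0 < c) (k : ℕ) :
    0 < watsonTerm a b c k :=
  mul_pos (hypCoeff_pos ha hb (by positivity) k)
    (div_pos (poch_pos hc k) (poch_pos (by positivity) k))

theorem isTheta_watsonTerm {a b c : ℝ} (ha : 0 < a) (hb : 0 < b) (hc : 0 < c) :
    watsonTerm a b c =Θ[atTop] fun k : ℕ => (k : ℝ) ^ ((a + b - 1) / 2 - c - 1) := by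
  refine ((isTheta_hypCoeff ha hb (show 0 < (a + b + 1) / 2 by positivity)).mul
    (isTheta_poch_div_poch hc (show 0 < 2 * c by positivity))).trans_eventuallyEq ?_
  filter_upwards [eventually_gt_atTop 0] with n hn
  have hn' : (0 : ℝ) < n := by exact_mod_cast hn
  rw [← Real.rpow_add hn']
  congr 1
  ring

theorem summable_watsonTerm {a b c : ℝ} (ha : 0 < a) (hb : 0 < b) (hc : 0 < c)
    (h : (a + b - 1) / 2 < c) : Summable (watsonTerm a b c) :=
  summable_of_isBigO_rpow (by linarith) (isTheta_watsonTerm ha hb hc).1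

theorem watsonTerm_succ {a b c : ℝ} (ha : 0 < a) (hb : 0 < b) (hc : 0 < c) (k : ℕ) :
    (k + 1) * ((a + b + 1) / 2 + k) * (2 * c + k) * watsonTerm a b c (k + 1) =
      (a + k) * (b + k) * (c + k) * watsonTerm a b c k := by
  have h := hypCoeff_succ (a := a) (b := b) (show 0 < (a + b + 1) / 2 by positivity) k
  have := poch_pos (show 0 < 2 * c by positivity) k
  have : 0 < 2 * c + k := by positivity
  simp only [watsonTerm, poch_succ]
  field_simp at h ⊢
  linear_combination poch c k * h

theorem watsonTerm_add_one {a b c : ℝ} (hc : 0 < c) (k : ℕ) :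
    (2 * c + k) * (2 * c + k + 1) * watsonTerm a b (c + 1) k =
      2 * (2 * c + 1) * (c + k) * watsonTerm a b c k := by
  have h1 := mul_poch_add_one c k
  have h2 := mul_poch_add_one (2 * c) k
  have h3 := mul_poch_add_one (2 * c + 1) k
  have p1 := poch_pos (show 0 < 2 * c by positivity) k
  have p2 := poch_pos (show 0 < 2 * c + 1 + 1 by positivity) k
  have p0 := poch_pos (show 0 < 2 * c + 1 by positivity) k
  simp only [watsonTerm, show 2 * (c + 1) = 2 * c + 1 + 1 by ring]
  rw [show poch (c + 1) k = (c + k) * poch c k / c by rw [eq_div_iff hc.ne', mul_comm, h1],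
    show poch (2 * c + 1 + 1) k = (2 * c + 1 + k) * poch (2 * c + 1) k / (2 * c + 1) by
      rw [eq_div_iff (by positivity), mul_comm, h3],
    show poch (2 * c + 1) k = (2 * c + k) * poch (2 * c) k / (2 * c) by
      rw [eq_div_iff (by positivity), mul_comm, h2]]
  have : 0 < 2 * c + k := by positivity
  have : 0 < 2 * c + 1 + k := by positivity
  field_simp
  ring

/-- The contiguous relation in the third parameter. The certificate is a rational function of k
tending to a constant times k · w k, where w is the summand, so it inherits the decay of k · w k. -/
theorem tsum_watsonTerm_recurrence {a b c : ℝ} (ha : 0 < a) (hb : 0 < b) (hc : 0 < c)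
    (h : (a + b - 1) / 2 < c) :
    ((c + 1 / 2) * (c + (1 - a - b) / 2)) * ∑' k, watsonTerm a b c k =
      ((c + (1 - a) / 2) * (c + (1 - b) / 2)) * ∑' k, watsonTerm a b (c + 1) k := by
  refine tsum_eq_of_telescoping
    (G := fun k => (c + 1 / 2) * (((a + b + 1) / 2 - 1 + k) / (2 * c + k) *
      (k * watsonTerm a b c k)))
    (summable_watsonTerm ha hb hc h) (summable_watsonTerm ha hb (by linarith) (by linarith)) ?_
    (by simp) ?_
  · intro k
    have h1 := watsonTerm_succ ha hb hc k
    have h2 := watsonTerm_add_one (a := a) (b := b) hc k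
    have e1 : 0 < 2 * c + k := by positivity
    have e2 : 0 < 2 * c + k + 1 := by positivity
    have e3 : 0 < 2 * c + (k + 1 : ℕ) := by positivity
    rw [show watsonTerm a b (c + 1) k = 2 * (2 * c + 1) * (c + k) * watsonTerm a b c k /
        ((2 * c + k) * (2 * c + k + 1)) by rw [eq_div_iff (by positivity), mul_comm, h2],
      show watsonTerm a b c (k + 1) = (a + k) * (b + k) * (c + k) * watsonTerm a b c k /
        ((k + 1) * ((a + b + 1) / 2 + k) * (2 * c + k)) by
          rw [eq_div_iff (by positivity), mul_comm, h1]]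
    push_cast
    have : (a + b + 1) / 2 + k ≠ 0 := by positivity
    have : a + b + 1 + 2 * k ≠ 0 := by positivity
    field_simp
    ring
  · have h1 := tendsto_natCast_mul_of_isBigO_rpow (by linarith) (isTheta_watsonTerm ha hb hc).1
    have h2 := (tendsto_add_div_add_atTop (x := (a + b + 1) / 2 - 1) (y := 2 * c)).mul h1
    simpa using h2.const_mul (c + 1 / 2)

/-- The quotient of the rising factorials of c and 2c is a product of factors (c+i)/(2c+i). Each
tends to 1/2 as c grows, and each decreases in c, so the series at n = 0 dominates. -/
theorem tendsto_tsum_watsonTerm {a b c : ℝ} (ha : 0 < a) (hb : 0 < b) (hc : 0 < c)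
    (h : (a + b - 1) / 2 < c) :
    Tendsto (fun n : ℕ => ∑' k, watsonTerm a b (c + n) k) atTop
      (𝓝 (∑' k, hypCoeff a b ((a + b + 1) / 2) k * (1 / 2) ^ k)) := by
  refine tendsto_tsum_of_dominated_convergence (summable_watsonTerm ha hb hc h) ?_ ?_
  · intro k
    refine Tendsto.const_mul _ ?_
    simp only [poch, ← prod_div_distrib]
    rw [show ((1 : ℝ) / 2) ^ k = ∏ i ∈ range k, (1 / 2 : ℝ) by simp]
    refine tendsto_finsetProd _ fun i _ => ?_
    have := (tendsto_add_div_add_atTop (x := c + i) (y := c + i / 2)).const_mul (1 / 2)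
    rw [mul_one] at this
    refine this.congr fun n => ?_
    have : 0 < c + i / 2 + n := by positivity
    have : 0 < 2 * (c + n) + i := by positivity
    field_simp
    ring
  · refine Eventually.of_forall fun n k => ?_
    rw [Real.norm_of_nonneg (watsonTerm_pos ha hb (by positivity) k).le]
    refine mul_le_mul_of_nonneg_left ?_ (hypCoeff_pos ha hb (by positivity) k).le
    simp only [poch, ← prod_div_distrib]
    refine prod_le_prod (fun i _ => by positivity) fun i _ => ?_
    rw [div_le_div_iff₀ (by positivity) (by positivity)]
    -- The two cross products differ by exactly n · i.
    have : (0 : ℝ) ≤ n * i := by positivity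
    nlinarith

/-- The ratio of the Watson series to its closed form does not depend on the third parameter. -/
theorem tsum_watsonTerm_div {a b c : ℝ} (ha : 0 < a) (hb : 0 < b) (hc : 0 < c)
    (h : (a + b - 1) / 2 < c) (hca : (a - 1) / 2 < c) (hcb : (b - 1) / 2 < c) :
    ∑' k, watsonTerm a b c k =
      (Real.Gamma (c + 1 / 2) * Real.Gamma (c + (1 - a - b) / 2) /
        (Real.Gamma (c + (1 - a) / 2) * Real.Gamma (c + (1 - b) / 2))) *
      ∑' k, hypCoeff a b ((a + b + 1) / 2) k * (1 / 2) ^ k := by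
  have h1 : 0 < c + (1 - a) / 2 := by linarith
  have h2 : 0 < c + (1 - b) / 2 := by linarith
  have h3 : 0 < c + (1 - a - b) / 2 := by linarith
  have h4 : 0 < c + 1 / 2 := by linarith
  have g0 {x : ℝ} (hx : 0 < x) (n : ℕ) : Real.Gamma (x + n) ≠ 0 :=
    (Real.Gamma_pos_of_pos (by positivity)).ne'
  have hg (n : ℕ) : Real.Gamma (c + 1 / 2 + n) * Real.Gamma (c + (1 - a - b) / 2 + n) /
      (Real.Gamma (c + (1 - a) / 2 + n) * Real.Gamma (c + (1 - b) / 2 + n)) ≠ 0 :=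
    div_ne_zero (mul_ne_zero (g0 h4 _) (g0 h3 _)) (mul_ne_zero (g0 h1 _) (g0 h2 _))
  have key := eq_of_recurrence_of_tendsto (f := fun n : ℕ => ∑' k, watsonTerm a b (c + n) k)
    (g := fun n : ℕ => Real.Gamma (c + 1 / 2 + n) * Real.Gamma (c + (1 - a - b) / 2 + n) /
      (Real.Gamma (c + (1 - a) / 2 + n) * Real.Gamma (c + (1 - b) / 2 + n)))
    (X := fun n : ℕ => (c + 1 / 2 + n) * (c + (1 - a - b) / 2 + n))
    (Y := fun n : ℕ => (c + (1 - a) / 2 + n) * (c + (1 - b) / 2 + n))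
    (l' := 1) ?_ ?_ (fun n => by positivity) (fun n => by positivity) hg
    (tendsto_tsum_watsonTerm ha hb hc h) (tendsto_Gamma_quotient h4 h3 h1 h2 (by ring)) one_ne_zero
  · rw [div_one, div_eq_iff (hg 0)] at key
    simp only [Nat.cast_zero, add_zero] at key
    rw [key, mul_comm]
  · intro n
    have hn : (0 : ℝ) ≤ n := by positivity
    have := tsum_watsonTerm_recurrence ha hb (show 0 < c + n by positivity) (by linarith)
    push_cast
    rw [← add_assoc]
    convert this using 2 <;> ring
  · intro n
    have s {x : ℝ} (hx : 0 < x) : Real.Gamma (x + (n + 1 : ℕ)) = (x + n) * Real.Gamma (x + n) := by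
      push_cast
      rw [← add_assoc, Real.Gamma_add_one (by positivity)]
    rw [s h1, s h2, s h3, s h4]
    have := g0 h1 n
    have := g0 h2 n
    have : 0 < c + (1 - a) / 2 + n := by positivity
    have : 0 < c + (1 - b) / 2 + n := by positivity
    generalize c + (1 - a) / 2 + n = A at *
    generalize c + (1 - b) / 2 + n = B at *
    field_simp

/-- **Gauss' second summation theorem**. -/
theorem tsum_hypCoeff_half {a b : ℝ} (ha : 0 < a) (hb : 0 < b) (hb1 : b < 1) :
    ∑' k, hypCoeff a b ((a + b + 1) / 2) k * (1 / 2) ^ k =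
      √Real.pi * Real.Gamma ((a + b + 1) / 2) /
        (Real.Gamma ((a + 1) / 2) * Real.Gamma ((b + 1) / 2)) := by
  -- For c = a/2 the denominator parameter 2c cancels the numerator parameter a, leaving ₂F₁(b, a/2;
  -- (a+b+1)/2; 1). Its convergence condition is b < 1.
  have h1 := tsum_watsonTerm_div (c := a / 2) ha hb (by positivity) (by linarith) (by linarith)
    (by linarith)
  have h2 : ∑' k, watsonTerm a b (a / 2) k = ∑' k, hypCoeff b (a / 2) ((a + b + 1) / 2) k := by
    refine tsum_congr fun k => ?_
    have := poch_pos ha k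
    have := poch_pos (show 0 < (a + b + 1) / 2 by positivity) k
    rw [watsonTerm, hypCoeff, hypCoeff, show 2 * (a / 2) = a by ring]
    field_simp
  rw [h2, tsum_hypCoeff hb (by positivity) (by linarith)] at h1
  rw [show (a + b + 1) / 2 - b - a / 2 = (1 - b) / 2 by ring,
    show (a + b + 1) / 2 - b = (a - b + 1) / 2 by ring,
    show (a + b + 1) / 2 - a / 2 = (b + 1) / 2 by ring,
    show a / 2 + 1 / 2 = (a + 1) / 2 by ring, show a / 2 + (1 - a - b) / 2 = (1 - b) / 2 by ring,
    show a / 2 + (1 - a) / 2 = 1 / 2 by ring, show a / 2 + (1 - b) / 2 = (a - b + 1) / 2 by ring,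
    Real.Gamma_one_half_eq] at h1
  have g {x : ℝ} (hx : 0 < x) : Real.Gamma x ≠ 0 := (Real.Gamma_pos_of_pos hx).ne'
  have := g (show 0 < (1 - b) / 2 by linarith)
  have := g (show 0 < (a - b + 1) / 2 by linarith)
  have := g (show 0 < (a + 1) / 2 by linarith)
  have := g (show 0 < (b + 1) / 2 by linarith)
  have : √Real.pi ≠ 0 := by positivity
  field_simp at h1 ⊢
  linear_combination -h1

/-- **Watson's summation theorem**. -/
theorem tsum_watsonTerm {a b c : ℝ} (ha : 0 < a) (hb : 0 < b) (hb1 : b < 1) (hc : 0 < c)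
    (h : (a + b - 1) / 2 < c) (hca : (a - 1) / 2 < c) :
    ∑' k, watsonTerm a b c k =
      (Real.Gamma (c + 1 / 2) * Real.Gamma (c + (1 - a - b) / 2) /
        (Real.Gamma (c + (1 - a) / 2) * Real.Gamma (c + (1 - b) / 2))) *
      (√Real.pi * Real.Gamma ((a + b + 1) / 2) /
        (Real.Gamma ((a + 1) / 2) * Real.Gamma ((b + 1) / 2))) := by
  rw [tsum_watsonTerm_div ha hb hc h hca (by linarith), tsum_hypCoeff_half ha hb hb1]

/-! ### Differentiating hypergeometric series in their parameters -/

/-- The logarithmic derivative `1/x + 1/(x + 1) + ⋯ + 1/(x + k - 1)` of the rising factorial. -/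
noncomputable def pochLogDeriv (x : ℝ) (k : ℕ) : ℝ := ∑ i ∈ range k, 1 / (x + i)

theorem pochLogDeriv_succ (x : ℝ) (k : ℕ) :
    pochLogDeriv x (k + 1) = pochLogDeriv x k + 1 / (x + k) := by
  simp [pochLogDeriv, sum_range_succ]

theorem pochLogDeriv_nonneg {x : ℝ} (hx : 0 < x) (k : ℕ) : 0 ≤ pochLogDeriv x k :=
  sum_nonneg fun i _ => by positivity

theorem pochLogDeriv_anti {x y : ℝ} (hx : 0 < x) (hxy : x ≤ y) (k : ℕ) :
    pochLogDeriv y k ≤ pochLogDeriv x k :=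
  sum_le_sum fun i _ => one_div_le_one_div_of_le (by positivity) (by linarith)

theorem pochLogDeriv_one (k : ℕ) : pochLogDeriv 1 k = harm k := by
  induction k with
  | zero => simp [pochLogDeriv, harm]
  | succ k ih =>
    rw [pochLogDeriv_succ, ih, harm, harm, harmonic_succ]
    push_cast
    rw [add_comm (1 : ℝ), one_div]

theorem hasDerivAt_poch {x : ℝ} (hx : 0 < x) (k : ℕ) :
    HasDerivAt (fun y => poch y k) (poch x k * pochLogDeriv x k) x := by
  induction k with
  | zero => simpa [pochLogDeriv] using hasDerivAt_const x (1 : ℝ)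
  | succ k ih =>
    have h := ih.mul ((hasDerivAt_id x).add_const (k : ℝ))
    rw [show (fun y => poch y (k + 1)) = (fun y => poch y k) * fun y => id y + (k : ℝ) by
      funext y; simp [poch_succ]]
    refine h.congr_deriv ?_
    have : 0 < x + k := by positivity
    rw [poch_succ, pochLogDeriv_succ]
    simp only [id]
    field_simp

/-- The right side is the product of the factors 1 + t/(x+i); expanding and keeping only the terms
linear in t gives the left side. -/
theorem mul_pochLogDeriv_le {x t : ℝ} (hx : 0 < x) (ht : 0 ≤ t) (k : ℕ) :
    1 + t * pochLogDeriv x k ≤ poch (x + t) k / poch x k := by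
  induction k with
  | zero => simp [pochLogDeriv]
  | succ k ih =>
    have h0 := pochLogDeriv_nonneg hx k
    have hk : 0 < x + k := by positivity
    have e : poch (x + t) (k + 1) / poch x (k + 1) =
        poch (x + t) k / poch x k * (1 + t * (1 / (x + k))) := by
      have := (poch_pos hx k).ne'
      rw [poch_succ, poch_succ]
      field_simp
      ring
    rw [e, pochLogDeriv_succ]
    have hu : 0 ≤ t * (1 / (x + k)) := by positivity
    have hv : 0 ≤ t * pochLogDeriv x k := by positivity
    nlinarith [mul_le_mul_of_nonneg_right ih (show 0 ≤ 1 + t * (1 / (x + k)) by positivity),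
      mul_nonneg hu hv]

/-- The true growth is logarithmic. An arbitrarily small power suffices for domination, and it
follows from the product bound together with the Gamma asymptotics. -/
theorem isBigO_pochLogDeriv {x t : ℝ} (hx : 0 < x) (ht : 0 < t) :
    (fun k => pochLogDeriv x k) =O[atTop] fun k : ℕ => (k : ℝ) ^ t := by
  have h := (isTheta_poch_div_poch (show 0 < x + t by positivity) hx).1
  rw [add_sub_cancel_left] at h
  refine IsBigO.trans (IsBigO.of_bound (1 / t) (Eventually.of_forall fun k => ?_)) h
  have h1 := mul_pochLogDeriv_le hx ht.le k
  rw [Real.norm_of_nonneg (pochLogDeriv_nonneg hx k), Real.norm_of_nonneg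
    (div_nonneg (poch_pos (by positivity) k).le (poch_pos hx k).le), one_div_mul_eq_div,
    le_div_iff₀ ht]
  linarith

theorem hypCoeff_mono {a b c a' b' c' : ℝ} (ha : 0 < a) (hb : 0 < b) (hc : 0 < c') (haa : a ≤ a')
    (hbb : b ≤ b') (hcc : c' ≤ c) (k : ℕ) : hypCoeff a b c k ≤ hypCoeff a' b' c' k := by
  have := poch_pos ha k
  have := poch_pos hb k
  have := poch_pos hc k
  have := poch_pos (ha.trans_le haa) k
  have := poch_le_poch ha haa k
  have := poch_le_poch hb hbb k
  have := poch_le_poch hc hcc k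
  unfold hypCoeff
  have : 0 < poch b' k := poch_pos (hb.trans_le hbb) k
  gcongr

theorem hasDerivAt_hypCoeff {a b s x : ℝ} (ha : 0 < a + x) (hb : 0 < b + x) (hs : 0 < 1 + s * x)
    (k : ℕ) :
    HasDerivAt (fun y => hypCoeff (a + y) (b + y) (1 + s * y) k)
      (hypCoeff (a + x) (b + x) (1 + s * x) k * (pochLogDeriv (a + x) k + pochLogDeriv (b + x) k -
        s * pochLogDeriv (1 + s * x) k)) x := by
  have d1 := (hasDerivAt_poch ha k).comp_const_add a x
  have d2 := (hasDerivAt_poch hb k).comp_const_add b x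
  have d3 : HasDerivAt (fun y => poch (1 + s * y) k)
      (poch (1 + s * x) k * pochLogDeriv (1 + s * x) k * s) x :=
    (hasDerivAt_poch hs k).comp (h := fun y => 1 + s * y) x
      ((((hasDerivAt_id x).const_mul s).const_add 1).congr_deriv (mul_one s))
  have hp := poch_pos hs k
  have hf : (k ! : ℝ) ≠ 0 := by positivity
  refine ((d1.mul d2).div (d3.mul_const (k ! : ℝ)) (by positivity)).congr_deriv ?_
  simp only [hypCoeff, Pi.mul_apply]
  field_simp

/-- Differentiating a weighted hypergeometric series with respect to its parameters. -/
theorem hasSum_deriv_hypCoeff {a b s q Φ' : ℝ} {v : ℕ → ℝ} {Φ : ℝ → ℝ} (ha : 1 / 16 < a)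
    (hb : 1 / 16 < b) (hab : a + b = 1) (hs0 : 0 ≤ s) (hs1 : s ≤ 1) (hq : 1 / 2 ≤ q)
    (hv0 : ∀ k, 0 ≤ v k) (hv : v =O[atTop] fun k : ℕ => (k : ℝ) ^ (-q))
    (hΦ : ∀ x ∈ Set.Ioo (-(1 / 16) : ℝ) (1 / 16),
      ∑' k, v k * hypCoeff (a + x) (b + x) (1 + s * x) k = Φ x)
    (hΦ' : HasDerivAt Φ Φ' 0) :
    HasSum (fun k => v k * (hypCoeff a b 1 k *
      (pochLogDeriv a k + pochLogDeriv b k - s * pochLogDeriv 1 k))) Φ' := by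
  obtain ⟨δ, hδ⟩ : ∃ δ : ℝ, δ = 1 / 16 := ⟨_, rfl⟩
  -- The majorant `u` takes each factor at its worst corner of the parameter box: `hypCoeff`
  -- increases in its upper parameters and decreases in the lower one, while `pochLogDeriv`
  -- decreases in its base.
  rw [← hδ] at ha hb hΦ
  set u : ℕ → ℝ := fun k => v k * (hypCoeff (a + δ) (b + δ) (1 - δ) k *
    (pochLogDeriv (a - δ) k + pochLogDeriv (b - δ) k + pochLogDeriv (1 - δ) k)) with hu_def
  have h1 : 0 < a - δ := by linarith
  have h2 : 0 < b - δ := by linarith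
  have h3 : 0 < 1 - δ := by norm_num [hδ]
  have hu : Summable u := by
    -- With a + b = 1 and δ = 1/16 the exponent is -q - 11/16, at most -19/16; the 1/8 pays for the
    -- logarithmic derivatives.
    refine summable_of_isBigO_rpow (p := -q + (a + δ + (b + δ) - (1 - δ) - 1 + 1 / 8))
      (by linarith) ?_
    have e1 := (isBigO_pochLogDeriv h1 (show (0 : ℝ) < 1 / 8 by norm_num)).add
      (isBigO_pochLogDeriv h2 (show (0 : ℝ) < 1 / 8 by norm_num)) |>.add
      (isBigO_pochLogDeriv h3 (show (0 : ℝ) < 1 / 8 by norm_num))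
    have e2 := (isTheta_hypCoeff (show 0 < a + δ by linarith) (show 0 < b + δ by linarith) h3).1
    refine (hv.mul (e2.mul e1)).trans_eventuallyEq ?_
    filter_upwards [eventually_gt_atTop 0] with n hn
    have hn' : (0 : ℝ) < n := by exact_mod_cast hn
    rw [← Real.rpow_add hn', ← Real.rpow_add hn']
  have hsx {x : ℝ} (hx : x ∈ Set.Ioo (-δ) δ) : 1 - δ ≤ 1 + s * x := by
    nlinarith [hx.1, hx.2]
  have hbound : ∀ k, ∀ x ∈ Set.Ioo (-δ) δ,
      ‖v k * (hypCoeff (a + x) (b + x) (1 + s * x) k * (pochLogDeriv (a + x) k +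
        pochLogDeriv (b + x) k - s * pochLogDeriv (1 + s * x) k))‖ ≤ u k := by
    intro k x hx
    have hx3 := hsx hx
    have hxa : a - δ ≤ a + x := by linarith [hx.1]
    have hxb : b - δ ≤ b + x := by linarith [hx.1]
    have p1 := pochLogDeriv_nonneg (h1.trans_le hxa) k
    have p2 := pochLogDeriv_nonneg (h2.trans_le hxb) k
    have p3 := pochLogDeriv_nonneg (h3.trans_le hx3) k
    have q1 := pochLogDeriv_anti h1 hxa k
    have q2 := pochLogDeriv_anti h2 hxb k
    have q3 := pochLogDeriv_anti h3 hx3 k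
    have hc0 := (hypCoeff_pos (h1.trans_le hxa) (h2.trans_le hxb) (h3.trans_le hx3) k).le
    have hc1 := hypCoeff_mono (h1.trans_le hxa) (h2.trans_le hxb) h3
      (show a + x ≤ a + δ by linarith [hx.2]) (show b + x ≤ b + δ by linarith [hx.2]) hx3 k
    rw [norm_mul, norm_mul, Real.norm_of_nonneg (hv0 k), Real.norm_of_nonneg hc0]
    refine mul_le_mul_of_nonneg_left (mul_le_mul hc1 ?_ (norm_nonneg _) (hc0.trans hc1)) (hv0 k)
    rw [Real.norm_eq_abs, abs_le]
    constructor <;> nlinarith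
  have h0 : (0 : ℝ) ∈ Set.Ioo (-δ) δ := by norm_num [hδ]
  have hderiv : ∀ k, ∀ x ∈ Set.Ioo (-δ) δ,
      HasDerivAt (fun x => v k * hypCoeff (a + x) (b + x) (1 + s * x) k)
        (v k * (hypCoeff (a + x) (b + x) (1 + s * x) k * (pochLogDeriv (a + x) k +
        pochLogDeriv (b + x) k - s * pochLogDeriv (1 + s * x) k))) x := by
    intro k x hx
    exact (hasDerivAt_hypCoeff (by linarith [hx.1]) (by linarith [hx.1])
      (h3.trans_le (hsx hx)) k).const_mul (v k)
  have hsum0 : Summable fun k => v k * hypCoeff (a + 0) (b + 0) (1 + s * 0) k := by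
    refine summable_of_isBigO_rpow (p := -q + (a + b - 1 - 1)) (by linarith) ?_
    simp only [add_zero, mul_zero]
    have e2 := (isTheta_hypCoeff (show 0 < a by linarith) (show 0 < b by linarith) one_pos).1
    refine (hv.mul e2).trans_eventuallyEq ?_
    filter_upwards [eventually_gt_atTop 0] with n hn
    have hn' : (0 : ℝ) < n := by exact_mod_cast hn
    rw [← Real.rpow_add hn']
  have key := hasDerivAt_tsum_of_isPreconnected hu isOpen_Ioo isPreconnected_Ioo hderiv hbound h0
    hsum0 h0
  have hval : Φ' = ∑' k, v k * (hypCoeff (a + 0) (b + 0) (1 + s * 0) k * (pochLogDeriv (a + 0) k +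
        pochLogDeriv (b + 0) k - s * pochLogDeriv (1 + s * 0) k)) := by
    refine hΦ'.unique (key.congr_of_eventuallyEq ?_)
    filter_upwards [isOpen_Ioo.mem_nhds h0] with x hx using (hΦ x hx).symm
  have hsummable : Summable fun k => v k * (hypCoeff (a + 0) (b + 0) (1 + s * 0) k *
      (pochLogDeriv (a + 0) k + pochLogDeriv (b + 0) k - s * pochLogDeriv (1 + s * 0) k)) :=
    Summable.of_norm_bounded hu fun k => hbound k 0 h0
  have := hsummable.hasSum
  rw [← hval] at this
  simpa using this

/-! ### Beta integrals and termwise integration -/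

open MeasureTheory in
theorem intervalIntegrable_beta_and_integral {p q : ℝ} (hp : 0 < p) (hq : 0 < q) :
    IntervalIntegrable (fun t : ℝ => t ^ (p - 1) * (1 - t) ^ (q - 1)) volume 0 1 ∧
      ∫ t in (0 : ℝ)..1, t ^ (p - 1) * (1 - t) ^ (q - 1) = ProbabilityTheory.beta p q := by
  have hc := Complex.betaIntegral_convergent (u := p) (v := q) (by simpa) (by simpa)
  -- On [0, 1] both bases are nonnegative, so the complex powers are coercions of real powers and
  -- the complex beta integral transfers.
  have he : Set.EqOn (fun t : ℝ => (t : ℂ) ^ ((p : ℂ) - 1) * (1 - (t : ℂ)) ^ ((q : ℂ) - 1))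
      (fun t : ℝ => ((t ^ (p - 1) * (1 - t) ^ (q - 1) : ℝ) : ℂ)) (Set.uIcc 0 1) := by
    intro t ht
    rw [Set.uIcc_of_le zero_le_one] at ht
    simp only
    rw [Complex.ofReal_mul, Complex.ofReal_cpow ht.1, Complex.ofReal_cpow (by linarith [ht.2])]
    push_cast
    rfl
  have hi : IntervalIntegrable (fun t : ℝ => ((t ^ (p - 1) * (1 - t) ^ (q - 1) : ℝ) : ℂ))
      volume 0 1 := hc.congr (he.mono Set.uIoc_subset_uIcc)
  constructor
  · have h2 : IntervalIntegrable (fun t : ℝ => ((t ^ (p - 1) * (1 - t) ^ (q - 1) : ℝ) : ℂ).re)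
        volume 0 1 := by
      rw [intervalIntegrable_iff] at hi ⊢
      exact hi.re
    simpa only [Complex.ofReal_re] using h2
  · rw [ProbabilityTheory.beta_eq_betaIntegralReal p q hp hq, Complex.betaIntegral,
      intervalIntegral.integral_congr he, intervalIntegral.integral_ofReal, Complex.ofReal_re]

open MeasureTheory in
/-- Termwise integration of a nonnegative power series against a beta density. -/
theorem integral_powerSeries_mul_beta {d : ℕ → ℝ} {p q v : ℝ} {f : ℝ → ℝ} (hp : 0 < p)
    (hq : 0 < q) (hd : ∀ k, 0 ≤ d k) {j : ℕ} (hj : 0 < d j)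
    (h : HasSum (fun k : ℕ => d k * ProbabilityTheory.beta (p + k) q) v)
    (hf : ∀ t ∈ Set.Ioo (0 : ℝ) 1, f t = (∑' k, d k * t ^ k) * (t ^ (p - 1) * (1 - t) ^ (q - 1))) :
    IntervalIntegrable f volume 0 1 ∧ ∫ t in (0 : ℝ)..1, f t = v := by
  set μ := volume.restrict (Set.Ioo (0 : ℝ) 1) with hμ
  set F : ℕ → ℝ → ℝ := fun k t => d k * (t ^ (p + k - 1) * (1 - t) ^ (q - 1)) with hF
  have hb (k : ℕ) := intervalIntegrable_beta_and_integral (p := p + k) (by positivity) hq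
  have hFi (k : ℕ) : Integrable (F k) μ := by
    have := (hb k).1
    rw [intervalIntegrable_iff_integrableOn_Ioo_of_le zero_le_one] at this
    exact Integrable.const_mul this (d k)
  have hFv (k : ℕ) : ∫ t, F k t ∂μ = d k * ProbabilityTheory.beta (p + k) q := by
    rw [← (hb k).2, intervalIntegral.integral_of_le zero_le_one, integral_Ioc_eq_integral_Ioo,
      ← integral_const_mul]
  have hFn (k : ℕ) : ∫ t, ‖F k t‖ ∂μ = d k * ProbabilityTheory.beta (p + k) q := by
    rw [← hFv k]
    refine setIntegral_congr_fun measurableSet_Ioo fun t ht => ?_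
    have h1 : 0 < t := ht.1
    have h2 : 0 < 1 - t := by linarith [ht.2]
    have := hd k
    exact Real.norm_of_nonneg (by simp only [hF]; positivity)
  have key := hasSum_integral_of_summable_integral_norm hFi (by simpa only [hFn] using h.summable)
  simp only [hFv] at key
  have hfF : Set.EqOn (fun t => ∑' k, F k t) f (Set.Ioo 0 1) := by
    intro t ht
    rw [hf t ht, ← tsum_mul_right]
    refine tsum_congr fun k => ?_
    have h1 : 0 < t := ht.1
    simp only [hF]
    rw [show p + k - 1 = p - 1 + k by ring, Real.rpow_add h1, Real.rpow_natCast]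
    ring
  rw [setIntegral_congr_fun measurableSet_Ioo hfF] at key
  have hval : ∫ t in Set.Ioo (0 : ℝ) 1, f t = v := key.unique h
  have hv : 0 < v := by
    have hbp (k : ℕ) : 0 < ProbabilityTheory.beta (p + k) q :=
      ProbabilityTheory.beta_pos (by positivity) hq
    refine (mul_pos hj (hbp j)).trans_le (le_hasSum h j fun k _ => ?_)
    exact mul_nonneg (hd k) (hbp k).le
  constructor
  · rw [intervalIntegrable_iff_integrableOn_Ioo_of_le zero_le_one]
    -- A non-integrable function has Bochner integral 0 by convention, whereas the value found is
    -- positive. This is where a strictly positive coefficient is needed.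
    by_contra hn
    rw [integral_undef hn] at hval
    exact hv.ne hval
  · rw [intervalIntegral.integral_of_le zero_le_one, integral_Ioc_eq_integral_Ioo, hval]

/-! ### Logarithmic derivative of the Gamma function -/

/-- The real digamma function. -/
noncomputable def psi (x : ℝ) : ℝ := deriv (fun y => Real.log (Real.Gamma y)) x

theorem hasDerivAt_Gamma {x : ℝ} (hx : 0 < x) :
    HasDerivAt Real.Gamma (Real.Gamma x * psi x) x := by
  have h : DifferentiableAt ℝ Real.Gamma x := Real.differentiableAt_Gamma fun m => by
    have : (0 : ℝ) ≤ m := by positivity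
    linarith
  have hG := (Real.Gamma_pos_of_pos hx).ne'
  rw [psi, deriv.log h hG, mul_div_cancel₀ _ hG]
  exact h.hasDerivAt

theorem psi_add_one {x : ℝ} (hx : 0 < x) : psi (x + 1) = psi x + 1 / x := by
  have h1 := (hasDerivAt_Gamma (show 0 < x + 1 by positivity)).comp_add_const x 1
  have h2 := (hasDerivAt_id x).mul (hasDerivAt_Gamma hx)
  have h3 : (fun y => Real.Gamma (y + 1)) =ᶠ[𝓝 x] (id * Real.Gamma) := by
    filter_upwards [eventually_gt_nhds hx] with y hy
    simp [Real.Gamma_add_one hy.ne']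
  have h4 := (h1.congr_of_eventuallyEq h3.symm).unique h2
  have hG := (Real.Gamma_pos_of_pos hx).ne'
  rw [Real.Gamma_add_one hx.ne'] at h4
  simp only [id] at h4
  field_simp
  apply mul_left_cancel₀ hG
  linear_combination h4

theorem psi_add_natCast {x : ℝ} (hx : 0 < x) (k : ℕ) :
    psi (x + k) = psi x + pochLogDeriv x k := by
  induction k with
  | zero => simp [pochLogDeriv]
  | succ k ih =>
    rw [Nat.cast_succ, ← add_assoc, psi_add_one (by positivity), ih, pochLogDeriv_succ, add_assoc]

/-- By convexity of log Γ, its derivative at x is at most its slope over [x, x+1], and the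
functional equation makes that slope log x. The next lemma uses the right endpoint in the same way.
-/
theorem psi_le_log {x : ℝ} (hx : 0 < x) : psi x ≤ Real.log x := by
  have hd : DifferentiableAt ℝ (fun y => Real.log (Real.Gamma y)) x :=
    (hasDerivAt_Gamma hx).differentiableAt.log (Real.Gamma_pos_of_pos hx).ne'
  refine (Real.convexOn_log_Gamma.deriv_le_slope (x := x) (y := x + 1) hx
    (show (0 : ℝ) < x + 1 by positivity) (by linarith) hd).trans (le_of_eq ?_)
  rw [slope_def_field, Function.comp_apply, Function.comp_apply, Real.Gamma_add_one hx.ne',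
    Real.log_mul hx.ne' (Real.Gamma_pos_of_pos hx).ne']
  ring

theorem log_le_psi {x : ℝ} (hx : 0 < x) : Real.log x ≤ psi (x + 1) := by
  have hx1 : 0 < x + 1 := by linarith
  have hd : DifferentiableAt ℝ (fun y => Real.log (Real.Gamma y)) (x + 1) :=
    (hasDerivAt_Gamma hx1).differentiableAt.log (Real.Gamma_pos_of_pos hx1).ne'
  refine (le_of_eq ?_).trans (Real.convexOn_log_Gamma.slope_le_deriv (x := x) (y := x + 1) hx
    (show (0 : ℝ) < x + 1 by positivity) (by linarith) hd)
  rw [slope_def_field, Function.comp_apply, Function.comp_apply, Real.Gamma_add_one hx.ne',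
    Real.log_mul hx.ne' (Real.Gamma_pos_of_pos hx).ne']
  ring

theorem tendsto_log_add_natCast_sub_log (x : ℝ) :
    Tendsto (fun n : ℕ => Real.log (x + n) - Real.log n) atTop (𝓝 0) := by
  have h := (tendsto_add_div_add_atTop (x := x) (y := 0)).log one_ne_zero
  rw [Real.log_one] at h
  refine h.congr' ?_
  filter_upwards [eventually_gt_atTop 0, tendsto_natCast_atTop_atTop.eventually_gt_atTop (-x)]
    with n hn hx
  have : (0 : ℝ) < n := by exact_mod_cast hn
  rw [zero_add, Real.log_div (by linarith) this.ne']

/-- The functional equation gives ψ(x) = ψ(x+n) - ∑ 1/(x+i), and ψ(x+n) - log n is squeezed to 0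
between log(x-1+n) - log n and log(x+n) - log n. Digamma values thus reduce to harmonic-number
limits. -/
theorem tendsto_log_sub_pochLogDeriv {x : ℝ} (hx : 0 < x) :
    Tendsto (fun n : ℕ => Real.log n - pochLogDeriv x n) atTop (𝓝 (psi x)) := by
  have h1 : Tendsto (fun n : ℕ => psi (x + n) - Real.log n) atTop (𝓝 0) := by
    refine tendsto_of_tendsto_of_tendsto_of_le_of_le' (tendsto_log_add_natCast_sub_log (x - 1))
      (tendsto_log_add_natCast_sub_log x) ?_ ?_
    · filter_upwards [eventually_gt_atTop 0] with n hn
      have : (1 : ℝ) ≤ n := by exact_mod_cast hn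
      have := log_le_psi (show 0 < x - 1 + n by linarith)
      rw [show x - 1 + n + 1 = x + n by ring] at this
      linarith
    · refine Eventually.of_forall fun n => ?_
      have := psi_le_log (show 0 < x + n by positivity)
      linarith
  have h2 := (tendsto_const_nhds (x := psi x)).sub h1
  rw [sub_zero] at h2
  refine h2.congr fun n => ?_
  rw [psi_add_natCast hx]
  ring

theorem tendsto_harm_sub_log :
    Tendsto (fun n : ℕ => harm n - Real.log n) atTop (𝓝 Real.eulerMascheroniConstant) :=
  Real.tendsto_harmonic_sub_log

theorem tendsto_harm_mul_sub_log {c : ℕ} (hc : 0 < c) :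
    Tendsto (fun n : ℕ => harm (c * n) - Real.log n) atTop
      (𝓝 (Real.eulerMascheroniConstant + Real.log c)) := by
  have h := (tendsto_harm_sub_log.comp (tendsto_id.const_mul_atTop' hc)).add_const (Real.log c)
  refine h.congr' ?_
  filter_upwards [eventually_gt_atTop 0] with n hn
  have h1 : (c : ℝ) ≠ 0 := by positivity
  have h2 : (n : ℝ) ≠ 0 := by positivity
  simp only [Function.comp, id, Nat.cast_mul, Real.log_mul h1 h2]
  ring

theorem psi_one : psi 1 = -Real.eulerMascheroniConstant := by
  refine tendsto_nhds_unique (tendsto_log_sub_pochLogDeriv one_pos) ?_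
  refine tendsto_harm_sub_log.neg.congr fun n => ?_
  rw [pochLogDeriv_one]
  ring

theorem harm_succ (n : ℕ) : harm (n + 1) = harm n + 1 / (n + 1) := by
  simp [harm, harmonic_succ]

@[simp] theorem harm_zero : harm 0 = 0 := by simp [harm]

theorem pochLogDeriv_half (k : ℕ) : pochLogDeriv (1 / 2) k = 2 * harm (2 * k) - harm k := by
  induction k with
  | zero => simp [pochLogDeriv]
  | succ k ih =>
    rw [pochLogDeriv_succ, ih, show 2 * (k + 1) = 2 * k + 1 + 1 by ring]
    simp only [harm_succ]
    push_cast
    field_simp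
    ring

/-- The left side is three times the sum of 1/j over j ≤ 3k not divisible by 3; the multiples of 3
are removed from `harm (3 * k)`. -/
theorem pochLogDeriv_third (k : ℕ) :
    pochLogDeriv (1 / 3) k + pochLogDeriv (2 / 3) k = 3 * harm (3 * k) - harm k := by
  induction k with
  | zero => simp [pochLogDeriv]
  | succ k ih =>
    rw [pochLogDeriv_succ, pochLogDeriv_succ, show 3 * (k + 1) = 3 * k + 1 + 1 + 1 by ring]
    simp only [harm_succ]
    push_cast
    rw [show 3 * (k : ℝ) + 2 + 1 = 3 * (k + 1) by ring]
    have : pochLogDeriv (1 / 3) k = 3 * harm (3 * k) - harm k - pochLogDeriv (2 / 3) k := by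
      linarith
    rw [this]
    field_simp
    ring

theorem pochLogDeriv_quarter (k : ℕ) :
    pochLogDeriv (1 / 4) k + pochLogDeriv (3 / 4) k = 4 * harm (4 * k) - 2 * harm (2 * k) := by
  induction k with
  | zero => simp [pochLogDeriv]
  | succ k ih =>
    rw [pochLogDeriv_succ, pochLogDeriv_succ, show 4 * (k + 1) = 4 * k + 1 + 1 + 1 + 1 by ring,
      show 2 * (k + 1) = 2 * k + 1 + 1 by ring]
    simp only [harm_succ]
    push_cast
    rw [show 4 * (k : ℝ) + 3 + 1 = 4 * (k + 1) by ring,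
      show 4 * (k : ℝ) + 1 + 1 = 2 * (2 * k + 1) by ring,
      show 2 * (k : ℝ) + 1 + 1 = 2 * (k + 1) by ring]
    have : pochLogDeriv (1 / 4) k = 4 * harm (4 * k) - 2 * harm (2 * k) - pochLogDeriv (3 / 4) k := by
      linarith
    rw [this]
    field_simp
    ring

/-- Inclusion–exclusion over the divisors 2 and 3: the left side is six times the sum of 1/j over j
≤ 6k coprime to 6. -/
theorem pochLogDeriv_sixth (k : ℕ) :
    pochLogDeriv (1 / 6) k + pochLogDeriv (5 / 6) k =
      6 * harm (6 * k) - 3 * harm (3 * k) - 2 * harm (2 * k) + harm k := by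
  induction k with
  | zero => simp [pochLogDeriv]
  | succ k ih =>
    rw [pochLogDeriv_succ, pochLogDeriv_succ,
      show 6 * (k + 1) = 6 * k + 1 + 1 + 1 + 1 + 1 + 1 by ring,
      show 3 * (k + 1) = 3 * k + 1 + 1 + 1 by ring, show 2 * (k + 1) = 2 * k + 1 + 1 by ring]
    simp only [harm_succ]
    push_cast
    rw [show 6 * (k : ℝ) + 5 + 1 = 6 * (k + 1) by ring,
      show 6 * (k : ℝ) + 3 + 1 = 2 * (3 * k + 1 + 1) by ring,
      show 6 * (k : ℝ) + 2 + 1 = 3 * (2 * k + 1) by ring,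
      show 6 * (k : ℝ) + 1 + 1 = 2 * (3 * k + 1) by ring,
      show 3 * (k : ℝ) + 2 + 1 = 3 * (k + 1) by ring,
      show 2 * (k : ℝ) + 1 + 1 = 2 * (k + 1) by ring]
    have : pochLogDeriv (1 / 6) k = 6 * harm (6 * k) - 3 * harm (3 * k) - 2 * harm (2 * k) +
      harm k - pochLogDeriv (5 / 6) k := by linarith
    rw [this]
    field_simp
    ring

theorem psi_half : psi (1 / 2) = -Real.eulerMascheroniConstant - 2 * Real.log 2 := by
  refine tendsto_nhds_unique (tendsto_log_sub_pochLogDeriv (by norm_num)) ?_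
  have h := ((tendsto_harm_mul_sub_log (c := 2) (by norm_num)).const_mul 2).sub
    tendsto_harm_sub_log |>.neg
  convert h using 2
  · rw [pochLogDeriv_half]; ring
  · push_cast; ring

/-- Only the symmetric sums ψ(a) + ψ(1-a) are needed, so the cotangent parts of the individual
values never appear. The identities for `pochLogDeriv` turn each sum into limits of `harm (c * n)`
minus log n. -/
theorem psi_third : psi (1 / 3) + psi (2 / 3) =
    -2 * Real.eulerMascheroniConstant - 3 * Real.log 3 := by
  refine tendsto_nhds_unique ((tendsto_log_sub_pochLogDeriv (by norm_num)).add
    (tendsto_log_sub_pochLogDeriv (by norm_num))) ?_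
  have h := ((tendsto_harm_mul_sub_log (c := 3) (by norm_num)).const_mul 3).sub
    tendsto_harm_sub_log |>.neg
  convert h using 2
  · linear_combination -pochLogDeriv_third _
  · push_cast; ring

theorem psi_quarter : psi (1 / 4) + psi (3 / 4) =
    -2 * Real.eulerMascheroniConstant - 6 * Real.log 2 := by
  refine tendsto_nhds_unique ((tendsto_log_sub_pochLogDeriv (by norm_num)).add
    (tendsto_log_sub_pochLogDeriv (by norm_num))) ?_
  have h := ((tendsto_harm_mul_sub_log (c := 4) (by norm_num)).const_mul 4).sub
    ((tendsto_harm_mul_sub_log (c := 2) (by norm_num)).const_mul 2) |>.neg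
  convert h using 2
  · linear_combination -pochLogDeriv_quarter _
  · push_cast
    rw [show (4 : ℝ) = 2 ^ 2 by norm_num, Real.log_pow]
    push_cast
    ring

theorem psi_sixth : psi (1 / 6) + psi (5 / 6) =
    -2 * Real.eulerMascheroniConstant - 4 * Real.log 2 - 3 * Real.log 3 := by
  refine tendsto_nhds_unique ((tendsto_log_sub_pochLogDeriv (by norm_num)).add
    (tendsto_log_sub_pochLogDeriv (by norm_num))) ?_
  have h := ((((tendsto_harm_mul_sub_log (c := 6) (by norm_num)).const_mul 6).sub
    ((tendsto_harm_mul_sub_log (c := 3) (by norm_num)).const_mul 3)).sub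
    ((tendsto_harm_mul_sub_log (c := 2) (by norm_num)).const_mul 2)).add
    tendsto_harm_sub_log |>.neg
  convert h using 2
  · linear_combination -pochLogDeriv_sixth _
  · push_cast
    rw [show (6 : ℝ) = 2 * 3 by norm_num, Real.log_mul (by norm_num) (by norm_num)]
    ring

/-! ### Legendre–Sun coefficients and their beta moments -/

theorem beta_add_natCast {p q : ℝ} (hp : 0 < p) (hq : 0 < q) (k : ℕ) :
    ProbabilityTheory.beta (p + k) q =
      ProbabilityTheory.beta p q * (poch p k / poch (p + q) k) := by
  have h1 := poch_pos (show 0 < p + q by positivity) k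
  have h2 := Real.Gamma_pos_of_pos (show 0 < p + q by positivity)
  rw [ProbabilityTheory.beta, ProbabilityTheory.beta, add_right_comm, Gamma_add_natCast hp,
    Gamma_add_natCast (by positivity)]
  field_simp

theorem isBigO_beta_add_natCast {p q : ℝ} (hp : 0 < p) (hq : 0 < q) :
    (fun k : ℕ => ProbabilityTheory.beta (p + k) q) =O[atTop] fun k : ℕ => (k : ℝ) ^ (-q) := by
  have h := (isTheta_poch_div_poch hp (show 0 < p + q by positivity)).1.const_mul_left
    (ProbabilityTheory.beta p q)
  rw [show p - (p + q) = -q by ring] at h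
  simpa only [beta_add_natCast hp hq] using h

/-- The coefficients of the Legendre–Sun series with parameters `a`, `b`, to which `s` times the
companion series is added. -/
noncomputable def lsCoeff (s a b : ℝ) (k : ℕ) : ℝ :=
  hypCoeff a b 1 k * (pochLogDeriv a k + pochLogDeriv b k - s * harm k)

theorem two_mul_pochLogDeriv_one_le {a b : ℝ} (ha : 0 < a) (hb : 0 < b) (hab : a + b = 1) (k : ℕ) :
    2 * harm k ≤ pochLogDeriv a k + pochLogDeriv b k := by
  have h1 := pochLogDeriv_anti ha (show a ≤ 1 by linarith) k
  have h2 := pochLogDeriv_anti hb (show b ≤ 1 by linarith) k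
  rw [pochLogDeriv_one] at h1 h2
  linarith

theorem harm_nonneg (k : ℕ) : 0 ≤ harm k := by
  rw [← pochLogDeriv_one]
  exact pochLogDeriv_nonneg one_pos k

theorem lsCoeff_nonneg {s a b : ℝ} (hs : s ≤ 1) (ha : 0 < a) (hb : 0 < b) (hab : a + b = 1)
    (k : ℕ) : 0 ≤ lsCoeff s a b k := by
  have h1 := two_mul_pochLogDeriv_one_le ha hb hab k
  have h2 := harm_nonneg k
  exact mul_nonneg (hypCoeff_pos ha hb one_pos k).le (by nlinarith)

/-- The coefficient at k = 0 vanishes, so index 1 supplies the strict positivity used to deduce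
integrability from a nonzero integral. -/
theorem lsCoeff_one_pos {s a b : ℝ} (hs : s ≤ 1) (ha : 0 < a) (hb : 0 < b) (hab : a + b = 1) :
    0 < lsCoeff s a b 1 := by
  have h1 := two_mul_pochLogDeriv_one_le ha hb hab 1
  have h2 : harm 1 = 1 := by simp [harm]
  rw [h2] at h1
  exact mul_pos (hypCoeff_pos ha hb one_pos 1) (by rw [h2]; linarith)

/-- The series with coefficients `₂F₁(a, b; 1; ·)` times a logarithmically growing sequence converge
inside the unit disc. -/
theorem summable_hypCoeff_mul_pow {a b : ℝ} (ha : 0 < a) (hb : 0 < b) (hab : a + b = 1)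
    {l : ℕ → ℝ} (hl : l =O[atTop] fun k : ℕ => (k : ℝ) ^ (1 : ℝ)) {t : ℝ} (ht : |t| < 1) :
    Summable fun k => hypCoeff a b 1 k * l k * t ^ k := by
  have h := ((isTheta_hypCoeff ha hb one_pos).1.mul hl).mul (isBigO_refl (fun k => t ^ k) atTop)
  have h1 : Summable fun k : ℕ => ‖t ^ k‖ := by
    simpa [norm_pow] using summable_geometric_of_lt_one (abs_nonneg t) ht
  refine summable_of_isBigO_nat h1 ((h.trans_eventuallyEq ?_).norm_right)
  filter_upwards [eventually_gt_atTop 0] with n hn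
  have hn' : (0 : ℝ) < n := by exact_mod_cast hn
  -- The coefficient decay k^(-1) cancels the allowed growth k, leaving the geometric factor.
  rw [← Real.rpow_add hn', hab]
  norm_num

theorem isBigO_harm : (fun k => harm k) =O[atTop] fun k : ℕ => (k : ℝ) ^ (1 : ℝ) := by
  simpa only [pochLogDeriv_one] using isBigO_pochLogDeriv one_pos one_pos

/-- A Legendre–Sun series against a beta density. -/
theorem integralEqSeriesEq_of_hasSum {s a b p q v C : ℝ} {f : ℝ → ℝ} {u : ℕ → ℝ} (hs : s ≤ 1)
    (ha : 0 < a) (hb : 0 < b) (hab : a + b = 1) (hp : 0 < p) (hq : 0 < q) (hC : 0 < C)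
    (h : HasSum (fun k : ℕ => lsCoeff s a b k * ProbabilityTheory.beta (p + k) q) v)
    (hf : ∀ t ∈ Set.Ioo (0 : ℝ) 1,
      f t = C * ((∑' k, lsCoeff s a b k * t ^ k) * (t ^ (p - 1) * (1 - t) ^ (q - 1))))
    (hu : ∀ k : ℕ, u k = C * (lsCoeff s a b k * ProbabilityTheory.beta (p + k) q)) :
    IntegralEqSeriesEq f u (C * v) := by
  have h' := h.mul_left C
  rw [← funext hu] at h'
  obtain ⟨h1, h2⟩ := integral_powerSeries_mul_beta (d := fun k => C * lsCoeff s a b k) (j := 1)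
    (v := C * v) (f := f) hp hq
    (fun k => mul_nonneg hC.le (lsCoeff_nonneg hs ha hb hab k))
    (mul_pos hC (lsCoeff_one_pos hs ha hb hab))
    (by simpa only [mul_assoc] using h.mul_left C) fun t ht => by
      rw [hf t ht]
      simp only [mul_assoc, tsum_mul_left]
  exact ⟨h1, h2, h'⟩

/-- The weight beta(1+k, q) is proportional to k!/(1+q)_k, so it replaces the lower parameter 1 by
1+q. Gauss' theorem then sums the family in x, and the formula is its derivative at x = 0. -/
theorem hasSum_lsCoeff_zero {a b q : ℝ} (ha : 1 / 16 < a) (hb : 1 / 16 < b) (hab : a + b = 1)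
    (hq : 1 / 2 ≤ q) :
    HasSum (fun k : ℕ => lsCoeff 0 a b k * ProbabilityTheory.beta (1 + k) q)
      (Real.Gamma q ^ 2 / (Real.Gamma (q + a) * Real.Gamma (q + b)) *
        (psi (q + a) + psi (q + b) - 2 * psi q)) := by
  have hq0 : 0 < q := by linarith
  have hG {x : ℝ} (hx : 0 < x) := hasDerivAt_Gamma hx
  have g {x : ℝ} (hx : 0 < x) : Real.Gamma x ≠ 0 := (Real.Gamma_pos_of_pos hx).ne'
  have hqa : 0 < q + a := by linarith
  have hqb : 0 < q + b := by linarith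
  have key := hasSum_deriv_hypCoeff (s := 0) (q := q)
    (v := fun k => ProbabilityTheory.beta (1 + k) q)
    (Φ := fun x => Real.Gamma q * Real.Gamma (q + -2 * x) /
      (Real.Gamma (q + b + -1 * x) * Real.Gamma (q + a + -1 * x)))
    (Φ' := Real.Gamma q ^ 2 / (Real.Gamma (q + a) * Real.Gamma (q + b)) *
        (psi (q + a) + psi (q + b) - 2 * psi q)) ha hb hab le_rfl zero_le_one hq
    (fun k => (ProbabilityTheory.beta_pos (by positivity) hq0).le)
    (isBigO_beta_add_natCast one_pos hq0) ?_ ?_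
  · refine key.congr_fun fun k => ?_
    simp only [lsCoeff, pochLogDeriv_one]
    ring
  · rintro x ⟨hx1, hx2⟩
    have h1 := tsum_hypCoeff (a := a + x) (b := b + x) (c := 1 + q) (by linarith) (by linarith)
      (by linarith)
    rw [show 1 + q - (a + x) - (b + x) = q + -2 * x by linear_combination -hab,
      show 1 + q - (a + x) = q + b + -1 * x by linear_combination -hab,
      show 1 + q - (b + x) = q + a + -1 * x by linear_combination -hab] at h1
    have h2 (k : ℕ) : ProbabilityTheory.beta (1 + k) q * hypCoeff (a + x) (b + x) (1 + 0 * x) k =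
        Real.Gamma q / Real.Gamma (1 + q) * hypCoeff (a + x) (b + x) (1 + q) k := by
      have := poch_pos (show 0 < 1 + q by positivity) k
      have := g (show 0 < 1 + q by positivity)
      rw [beta_add_natCast one_pos hq0, ProbabilityTheory.beta, Real.Gamma_one, hypCoeff, hypCoeff,
        zero_mul, add_zero, poch_one]
      field_simp
    simp only [h2, tsum_mul_left, h1]
    have := g (show 0 < 1 + q by positivity)
    field_simp
  · have lin (c y : ℝ) : HasDerivAt (fun x : ℝ => y + c * x) c 0 :=
      (((hasDerivAt_id (0 : ℝ)).const_mul c).const_add y).congr_deriv (mul_one c)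
    have cmp {c y : ℝ} (hy : 0 < y) : HasDerivAt (fun x : ℝ => Real.Gamma (y + c * x))
        (Real.Gamma y * psi y * c) 0 := by
      have h := hG (show 0 < y + c * 0 by simpa using hy)
      have := h.comp (h := fun x : ℝ => y + c * x) 0 (lin c y)
      simpa [Function.comp_def] using this
    refine (((cmp (c := -2) hq0).const_mul (Real.Gamma q)).div
      ((cmp (c := -1) hqb).mul (cmp (c := -1) hqa)) ?_).congr_deriv ?_
    · simpa using ⟨g hqb, g hqa⟩
    · have := g hqa
      have := g hqb
      simp only [Pi.mul_apply, mul_zero, add_zero]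
      field_simp
      ring

/-- The weight beta(q+k, q) contributes (q)_k/(2q)_k. Moving the lower parameter as 1+x keeps it at
half of (a+x)+(b+x)+1, so Watson's theorem applies for every small x and can be differentiated. -/
theorem hasSum_lsCoeff_one {a b q : ℝ} (ha : 1 / 16 < a) (hb : 1 / 16 < b) (hab : a + b = 1)
    (hq : 1 / 2 ≤ q) :
    HasSum (fun k : ℕ => lsCoeff 1 a b k * ProbabilityTheory.beta (q + k) q)
      (Real.Gamma q ^ 2 / Real.Gamma (2 * q) * (Real.Gamma (q + 1 / 2) * Real.Gamma q /
          (Real.Gamma (q + a / 2) * Real.Gamma (q + b / 2)) *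
        (√Real.pi / (Real.Gamma ((1 + a) / 2) * Real.Gamma ((1 + b) / 2)))) *
        (psi 1 - psi q + (psi (q + a / 2) + psi (q + b / 2) - psi ((1 + a) / 2) -
          psi ((1 + b) / 2)) / 2)) := by
  have hq0 : 0 < q := by linarith
  have hG {x : ℝ} (hx : 0 < x) := hasDerivAt_Gamma hx
  have g {x : ℝ} (hx : 0 < x) : Real.Gamma x ≠ 0 := (Real.Gamma_pos_of_pos hx).ne'
  have hqa : 0 < q + a / 2 := by linarith
  have hqb : 0 < q + b / 2 := by linarith
  have hA : 0 < (1 + a) / 2 := by linarith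
  have hB : 0 < (1 + b) / 2 := by linarith
  have key := hasSum_deriv_hypCoeff (s := 1) (q := q)
    (v := fun k => ProbabilityTheory.beta (q + k) q)
    (Φ := fun x => ProbabilityTheory.beta q q * (
      (Real.Gamma (q + 1 / 2) * Real.Gamma (q + -1 * x) /
        (Real.Gamma (q + b / 2 + -(1 / 2) * x) * Real.Gamma (q + a / 2 + -(1 / 2) * x))) *
      (√Real.pi * Real.Gamma (1 + 1 * x) /
        (Real.Gamma ((1 + a) / 2 + 1 / 2 * x) * Real.Gamma ((1 + b) / 2 + 1 / 2 * x)))))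
    (Φ' := Real.Gamma q ^ 2 / Real.Gamma (2 * q) * (Real.Gamma (q + 1 / 2) * Real.Gamma q /
          (Real.Gamma (q + a / 2) * Real.Gamma (q + b / 2)) *
        (√Real.pi / (Real.Gamma ((1 + a) / 2) * Real.Gamma ((1 + b) / 2)))) *
        (psi 1 - psi q + (psi (q + a / 2) + psi (q + b / 2) - psi ((1 + a) / 2) -
          psi ((1 + b) / 2)) / 2)) ha hb hab zero_le_one le_rfl hq
    (fun k => (ProbabilityTheory.beta_pos (by positivity) hq0).le)
    (isBigO_beta_add_natCast hq0 hq0) ?_ ?_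
  · refine key.congr_fun fun k => ?_
    simp only [lsCoeff, pochLogDeriv_one]
    ring
  · rintro x ⟨hx1, hx2⟩
    have h1 := tsum_watsonTerm (a := a + x) (b := b + x) (c := q) (by linarith) (by linarith)
      (by linarith) hq0 (by linarith) (by linarith)
    rw [show q + (1 - (a + x) - (b + x)) / 2 = q + -1 * x by linear_combination -hab / 2,
      show q + (1 - (a + x)) / 2 = q + b / 2 + -(1 / 2) * x by linear_combination -hab / 2,
      show q + (1 - (b + x)) / 2 = q + a / 2 + -(1 / 2) * x by linear_combination -hab / 2,
      show (a + x + (b + x) + 1) / 2 = 1 + 1 * x by linear_combination hab / 2,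
      show (a + x + 1) / 2 = (1 + a) / 2 + 1 / 2 * x by ring,
      show (b + x + 1) / 2 = (1 + b) / 2 + 1 / 2 * x by ring] at h1
    rw [← h1, ← tsum_mul_left]
    refine tsum_congr fun k => ?_
    rw [beta_add_natCast hq0 hq0, watsonTerm,
      show (a + x + (b + x) + 1) / 2 = 1 + 1 * x by linear_combination hab / 2, two_mul]
    ring
  · have lin (c y : ℝ) : HasDerivAt (fun x : ℝ => y + c * x) c 0 :=
      (((hasDerivAt_id (0 : ℝ)).const_mul c).const_add y).congr_deriv (mul_one c)
    have cmp {c y : ℝ} (hy : 0 < y) : HasDerivAt (fun x : ℝ => Real.Gamma (y + c * x))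
        (Real.Gamma y * psi y * c) 0 := by
      have h := hG (show 0 < y + c * 0 by simpa using hy)
      have := h.comp (h := fun x : ℝ => y + c * x) 0 (lin c y)
      simpa [Function.comp_def] using this
    have n1 := g hqa
    have n2 := g hqb
    have n3 := g hA
    have n4 := g hB
    have n5 := g (show 0 < 2 * q by positivity)
    refine (((((cmp (c := -1) hq0).const_mul (Real.Gamma (q + 1 / 2))).div
      ((cmp (c := -(1 / 2)) hqb).mul (cmp (c := -(1 / 2)) hqa)) ?_).mul
      (((cmp (c := 1) one_pos).const_mul √Real.pi).div
        ((cmp (c := 1 / 2) hA).mul (cmp (c := 1 / 2) hB)) ?_)).const_mul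
        (ProbabilityTheory.beta q q)).congr_deriv ?_
    · simpa using ⟨n2, n1⟩
    · simpa using ⟨n3, n4⟩
    · simp only [Pi.mul_apply, Pi.div_apply, mul_zero, add_zero, Real.Gamma_one,
        ProbabilityTheory.beta, ← two_mul]
      generalize Real.Gamma (q + a / 2) = X1 at *
      generalize Real.Gamma (q + b / 2) = X2 at *
      generalize Real.Gamma ((1 + a) / 2) = X3 at *
      generalize Real.Gamma ((1 + b) / 2) = X4 at *
      generalize Real.Gamma (2 * q) = X5 at *
      generalize Real.Gamma (q + 1 / 2) = X6 at *
      generalize psi (q + a / 2) = Y1 at *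
      generalize psi (q + b / 2) = Y2 at *
      generalize psi ((1 + a) / 2) = Y3 at *
      generalize psi ((1 + b) / 2) = Y4 at *
      field_simp
      ring

/-! ### Double factorials and beta integrals at half-integers -/

theorem doubleFactorial_two_mul_sub_one (n : ℕ) :
    ((2 * n - 1)‼ : ℝ) = 2 ^ n * poch (1 / 2) n := by
  induction n with
  | zero => simp
  | succ n ih =>
    -- The step from 2n - 1 to 2n + 1 fails at n = 0, where truncated subtraction gives 0 instead of
    -- -1; hence the separate case.
    rcases n with _ | n
    · simp [poch]
    · rw [show 2 * (n + 1 + 1) - 1 = (2 * (n + 1) - 1) + 2 by omega, Nat.doubleFactorial_add_two,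
        Nat.cast_mul, ih, poch_succ _ (n + 1), show 2 * (n + 1) - 1 + 2 = 2 * n + 3 by omega]
      push_cast
      ring

theorem factorial_two_mul (k : ℕ) : ((2 * k)! : ℝ) = 4 ^ k * poch (1 / 2) k * k ! := by
  induction k with
  | zero => simp
  | succ k ih =>
    rw [show 2 * (k + 1) = 2 * k + 1 + 1 by ring]
    simp only [Nat.factorial_succ, poch_succ]
    push_cast
    rw [ih]
    ring

theorem factorial_three_mul (k : ℕ) :
    ((3 * k)! : ℝ) = 27 ^ k * (poch (1 / 3) k * poch (2 / 3) k) * k ! := by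
  induction k with
  | zero => simp
  | succ k ih =>
    rw [show 3 * (k + 1) = 3 * k + 1 + 1 + 1 by ring]
    simp only [Nat.factorial_succ, poch_succ]
    push_cast
    rw [ih]
    ring

theorem factorial_four_mul (k : ℕ) :
    ((4 * k)! : ℝ) = 64 ^ k * (poch (1 / 4) k * poch (3 / 4) k) * (2 * k)! := by
  induction k with
  | zero => simp
  | succ k ih =>
    rw [show 4 * (k + 1) = 4 * k + 1 + 1 + 1 + 1 by ring, show 2 * (k + 1) = 2 * k + 1 + 1 by ring]
    simp only [Nat.factorial_succ, poch_succ]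
    push_cast
    rw [ih]
    ring

/-- The multiplicative form of the inclusion–exclusion modulo 6: only the factors coprime to 6
survive, giving the rising factorials of 1/6 and 5/6. -/
theorem factorial_six_mul (k : ℕ) :
    ((6 * k)! : ℝ) * k ! = 432 ^ k * (poch (1 / 6) k * poch (5 / 6) k) * (3 * k)! * (2 * k)! := by
  induction k with
  | zero => simp
  | succ k ih =>
    rw [show 6 * (k + 1) = 6 * k + 1 + 1 + 1 + 1 + 1 + 1 by ring,
      show 3 * (k + 1) = 3 * k + 1 + 1 + 1 by ring, show 2 * (k + 1) = 2 * k + 1 + 1 by ring]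
    simp only [Nat.factorial_succ, poch_succ]
    push_cast
    linear_combination ((6 * (k : ℝ) + 5 + 1) * (6 * k + 4 + 1) * (6 * k + 3 + 1) *
      (6 * k + 2 + 1) * (6 * k + 1 + 1) * (6 * k + 1) * (k + 1)) * ih

theorem choose_two_mul (k : ℕ) : ((2 * k).choose k : ℝ) = (2 * k)! / (k ! * k !) := by
  rw [Nat.cast_choose ℝ (by omega : k ≤ 2 * k), show 2 * k - k = k by omega]

theorem choose_three_mul (k : ℕ) : ((3 * k).choose k : ℝ) = (3 * k)! / (k ! * (2 * k)!) := by
  rw [Nat.cast_choose ℝ (by omega : k ≤ 3 * k), show 3 * k - k = 2 * k by omega]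

theorem choose_four_mul (k : ℕ) :
    ((4 * k).choose (2 * k) : ℝ) = (4 * k)! / ((2 * k)! * (2 * k)!) := by
  rw [Nat.cast_choose ℝ (by omega : 2 * k ≤ 4 * k), show 4 * k - 2 * k = 2 * k by omega]

theorem choose_six_mul (k : ℕ) :
    ((6 * k).choose (3 * k) : ℝ) = (6 * k)! / ((3 * k)! * (3 * k)!) := by
  rw [Nat.cast_choose ℝ (by omega : 3 * k ≤ 6 * k), show 6 * k - 3 * k = 3 * k by omega]

theorem beta_one_add (m k : ℕ) :
    ProbabilityTheory.beta (1 + k) (1 / 2 + m) =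
      2 * 4 ^ k / ((2 * k).choose k : ℝ) * dfRatioA m k := by
  have e1 : 2 * k + 2 * m + 1 = 2 * (k + m + 1) - 1 := by omega
  have h (n : ℕ) := poch_pos (show (0 : ℝ) < 1 / 2 by norm_num) n
  have := h k
  have := h (k + m + 1)
  have : 0 < √Real.pi := by positivity
  have : (0 : ℝ) < k ! := by positivity
  rw [dfRatioA, e1]
  simp only [doubleFactorial_two_mul_sub_one, choose_two_mul, factorial_two_mul]
  rw [ProbabilityTheory.beta,
    show (1 : ℝ) + k + (1 / 2 + m) = 1 / 2 + ((k + m + 1 : ℕ) : ℝ) by push_cast; ring,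
    Gamma_add_natCast one_pos, Gamma_add_natCast (by norm_num), Gamma_add_natCast (by norm_num),
    Real.Gamma_one, Real.Gamma_one_half_eq, poch_one]
  field_simp
  ring

/-- The Gamma values at the two half-integers each carry √π; the factor 1/π of the integrand cancels
them. -/
theorem beta_half_add (m k : ℕ) :
    1 / Real.pi * ProbabilityTheory.beta (1 / 2 + m + k) (1 / 2 + m) =
      ((2 * k).choose k : ℝ) / 2 ^ (2 * k + 3 * m) * dfRatioB m k := by
  have e1 : 2 * k + 2 * m - 1 = 2 * (k + m) - 1 := by omega
  have h (n : ℕ) := poch_pos (show (0 : ℝ) < 1 / 2 by norm_num) n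
  have := h k
  have := h m
  have : (0 : ℝ) < k ! := by positivity
  have : (0 : ℝ) < m ! := by positivity
  have : (0 : ℝ) < (k + 2 * m)! := by positivity
  have hpi := Real.pi_pos
  have hs := Real.mul_self_sqrt hpi.le
  rw [dfRatioB, e1, Nat.cast_choose ℝ (by omega : k ≤ k + 2 * m), Nat.add_sub_cancel_left]
  simp only [doubleFactorial_two_mul_sub_one, choose_two_mul, factorial_two_mul]
  rw [ProbabilityTheory.beta,
    show (1 : ℝ) / 2 + m + k + (1 / 2 + m) = 1 + ((k + 2 * m : ℕ) : ℝ) by push_cast; ring,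
    show (1 : ℝ) / 2 + m + k = 1 / 2 + ((k + m : ℕ) : ℝ) by push_cast; ring,
    Gamma_add_natCast one_pos, Gamma_add_natCast (by norm_num), Gamma_add_natCast (by norm_num),
    Real.Gamma_one, Real.Gamma_one_half_eq, poch_one]
  have e2 : poch (1 / 2) (k + m) * √Real.pi * (poch (1 / 2) m * √Real.pi) =
      poch (1 / 2) (k + m) * poch (1 / 2) m * Real.pi := by
    linear_combination poch (1 / 2) (k + m) * poch (1 / 2) m * hs
  rw [e2]
  simp only [pow_add, pow_mul]
  field_simp
  rw [show (2 : ℝ) ^ 3 = 4 * 2 by norm_num, mul_pow, show (2 : ℝ) ^ 2 = 4 by norm_num]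
  field_simp

/-! ### Computable rational sequences -/

theorem ComputableRatSeq.const (c : ℚ) : ComputableRatSeq fun _ => c := by
  -- The integer numerator is split into its positive and negative parts.
  refine ⟨fun _ => c.num.toNat, fun _ => (-c.num).toNat, fun _ => c.den, Computable.const _,
    Computable.const _, Computable.const _, fun _ => ⟨c.den_nz, ?_⟩⟩
  have h : ((c.num.toNat : ℚ) - ((-c.num).toNat : ℚ)) = c.num := by
    have : (c.num.toNat : ℤ) - ((-c.num).toNat : ℤ) = c.num := by omega
    exact_mod_cast this
  rw [h, Rat.num_div_den]

theorem ComputableRatSeq.natCast : ComputableRatSeq fun m => (m : ℚ) :=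
  ⟨fun m => m, fun _ => 0, fun _ => 1, Computable.id, Computable.const _, Computable.const _,
    fun m => ⟨one_ne_zero, by simp⟩⟩

theorem Computable.nat_add' {f g : ℕ → ℕ} (hf : Computable f) (hg : Computable g) :
    Computable fun m => f m + g m :=
  Primrec.nat_add.to_comp.comp hf hg

theorem Computable.nat_mul' {f g : ℕ → ℕ} (hf : Computable f) (hg : Computable g) :
    Computable fun m => f m * g m :=
  Primrec.nat_mul.to_comp.comp hf hg

theorem ComputableRatSeq.add {c c' : ℕ → ℚ} (h : ComputableRatSeq c) (h' : ComputableRatSeq c') :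
    ComputableRatSeq fun m => c m + c' m := by
  obtain ⟨p, q, d, hp, hq, hd, H⟩ := h
  obtain ⟨p', q', d', hp', hq', hd', H'⟩ := h'
  refine ⟨_, _, _, (hp.nat_mul' hd').nat_add' (hp'.nat_mul' hd),
    (hq.nat_mul' hd').nat_add' (hq'.nat_mul' hd), hd.nat_mul' hd', fun m => ?_⟩
  obtain ⟨h1, h2⟩ := H m
  obtain ⟨h1', h2'⟩ := H' m
  refine ⟨mul_ne_zero h1 h1', ?_⟩
  have : (d m : ℚ) ≠ 0 := by exact_mod_cast h1
  have : (d' m : ℚ) ≠ 0 := by exact_mod_cast h1'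
  beta_reduce
  rw [h2, h2']
  push_cast
  field_simp
  ring

theorem ComputableRatSeq.mul {c c' : ℕ → ℚ} (h : ComputableRatSeq c) (h' : ComputableRatSeq c') :
    ComputableRatSeq fun m => c m * c' m := by
  obtain ⟨p, q, d, hp, hq, hd, H⟩ := h
  obtain ⟨p', q', d', hp', hq', hd', H'⟩ := h'
  refine ⟨_, _, _, (hp.nat_mul' hp').nat_add' (hq.nat_mul' hq'),
    (hp.nat_mul' hq').nat_add' (hq.nat_mul' hp'), hd.nat_mul' hd', fun m => ?_⟩
  obtain ⟨h1, h2⟩ := H m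
  obtain ⟨h1', h2'⟩ := H' m
  refine ⟨mul_ne_zero h1 h1', ?_⟩
  have : (d m : ℚ) ≠ 0 := by exact_mod_cast h1
  have : (d' m : ℚ) ≠ 0 := by exact_mod_cast h1'
  beta_reduce
  rw [h2, h2']
  push_cast
  field_simp
  ring

theorem ComputableRatSeq.inv {c : ℕ → ℚ} (h : ComputableRatSeq c) (h0 : ∀ m, c m ≠ 0) :
    ComputableRatSeq fun m => (c m)⁻¹ := by
  obtain ⟨p, q, d, hp, hq, hd, H⟩ := h
  -- With truncated subtraction this sum is |p - q|. The inverse is written as d(p - q)/(p - q)²,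
  -- whose denominator is a natural number whatever the sign.
  have hs : Computable fun m => (p m - q m) + (q m - p m) :=
    (Primrec.nat_sub.to_comp.comp hp hq).nat_add' (Primrec.nat_sub.to_comp.comp hq hp)
  refine ⟨_, _, _, hd.nat_mul' hp, hd.nat_mul' hq, hs.nat_mul' hs, fun m => ?_⟩
  obtain ⟨h1, h2⟩ := H m
  have hc := h0 m
  beta_reduce
  rw [h2] at hc ⊢
  have hd0 : (d m : ℚ) ≠ 0 := by exact_mod_cast h1
  have hpq : (p m : ℚ) - q m ≠ 0 := fun h => hc (by rw [h, zero_div])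
  have hsq : ((((p m - q m) + (q m - p m)) * ((p m - q m) + (q m - p m)) : ℕ) : ℚ) =
      ((p m : ℚ) - q m) * ((p m : ℚ) - q m) := by
    rcases le_total (p m) (q m) with h | h
    · rw [Nat.sub_eq_zero_of_le h, Nat.zero_add, Nat.cast_mul, Nat.cast_sub h]
      ring
    · rw [Nat.sub_eq_zero_of_le h, Nat.add_zero, Nat.cast_mul, Nat.cast_sub h]
  refine ⟨fun h => ?_, ?_⟩
  · rw [h, Nat.cast_zero] at hsq
    exact mul_ne_zero hpq hpq hsq.symm
  · rw [hsq]
    push_cast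
    field_simp

/-- Primitive recursion on triples (p, q, d) representing (p - q)/d, without reducing fractions.
Finite products and finite sums of computable sequences are the two special cases. -/
theorem ComputableRatSeq.recurrence {c f g : ℕ → ℚ} (hf : ComputableRatSeq f)
    (hg : ComputableRatSeq g) (hc : ∀ m, c (m + 1) = f m * c m + g m) : ComputableRatSeq c := by
  obtain ⟨p, q, d, hp, hq, hd, H⟩ := hf
  obtain ⟨p', q', d', hp', hq', hd', H'⟩ := hg
  obtain ⟨p₀, q₀, d₀, -, -, -, H₀⟩ := ComputableRatSeq.const (c 0)
  let step : ℕ → ℕ × ℕ × ℕ → ℕ × ℕ × ℕ := fun m x =>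
    ((p m * x.1 + q m * x.2.1) * d' m + p' m * (d m * x.2.2),
      (p m * x.2.1 + q m * x.1) * d' m + q' m * (d m * x.2.2), d m * x.2.2 * d' m)
  let F : ℕ → ℕ × ℕ × ℕ := fun m => Nat.rec (p₀ 0, q₀ 0, d₀ 0) step m
  have add {f g : ℕ × ℕ × (ℕ × ℕ × ℕ) → ℕ} (hf : Computable f) (hg : Computable g) :
    Computable fun m => f m + g m := Primrec.nat_add.to_comp.comp hf hg
  have mul {f g : ℕ × ℕ × (ℕ × ℕ × ℕ) → ℕ} (hf : Computable f) (hg : Computable g) :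
    Computable fun m => f m * g m := Primrec.nat_mul.to_comp.comp hf hg
  have hstep : Computable₂ fun (_ : ℕ) (y : ℕ × (ℕ × ℕ × ℕ)) => step y.1 y.2 := by
    have hm : Computable fun y : ℕ × ℕ × (ℕ × ℕ × ℕ) => y.2.1 := Computable.fst.comp Computable.snd
    have hx : Computable fun y : ℕ × ℕ × (ℕ × ℕ × ℕ) => y.2.2 := Computable.snd.comp Computable.snd
    have h1 := Computable.fst.comp hx
    have h2 := Computable.fst.comp (Computable.snd.comp hx)
    have h3 := Computable.snd.comp (Computable.snd.comp hx)
    exact Computable.pair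
      (add (mul (add (mul (hp.comp hm) h1) (mul (hq.comp hm) h2)) (hd'.comp hm))
        (mul (hp'.comp hm) (mul (hd.comp hm) h3)))
      (Computable.pair
        (add (mul (add (mul (hp.comp hm) h2) (mul (hq.comp hm) h1)) (hd'.comp hm))
          (mul (hq'.comp hm) (mul (hd.comp hm) h3)))
        (mul (mul (hd.comp hm) h3) (hd'.comp hm)))
  have hF : Computable F :=
    Computable.nat_rec (f := fun m : ℕ => m) (g := fun _ => (p₀ 0, q₀ 0, d₀ 0)) Computable.id
      (Computable.const _) hstep
  refine ⟨fun m => (F m).1, fun m => (F m).2.1, fun m => (F m).2.2, Computable.fst.comp hF,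
    Computable.fst.comp (Computable.snd.comp hF), Computable.snd.comp (Computable.snd.comp hF),
    fun m => ?_⟩
  induction m with
  | zero => exact H₀ 0
  | succ m ih =>
    obtain ⟨h1, h2⟩ := H m
    obtain ⟨h1', h2'⟩ := H' m
    obtain ⟨h3, h4⟩ := ih
    beta_reduce at h3 h4 ⊢
    have e : F (m + 1) = step m (F m) := rfl
    have hne : d m * (F m).2.2 * d' m ≠ 0 := mul_ne_zero (mul_ne_zero h1 h3) h1'
    refine ⟨by rw [e]; exact hne, ?_⟩
    have : (d m : ℚ) ≠ 0 := by exact_mod_cast h1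
    have : (d' m : ℚ) ≠ 0 := by exact_mod_cast h1'
    have : ((F m).2.2 : ℚ) ≠ 0 := by exact_mod_cast h3
    rw [hc, h2, h2', h4, e]
    simp only [step]
    push_cast
    field_simp
    ring

theorem ComputableRatSeq.prod_range {f : ℕ → ℚ} (hf : ComputableRatSeq f) :
    ComputableRatSeq fun m => ∏ i ∈ range m, f i :=
  hf.recurrence (ComputableRatSeq.const 0) fun m => by rw [Finset.prod_range_succ]; ring

theorem ComputableRatSeq.sum_range {f : ℕ → ℚ} (hf : ComputableRatSeq f) :
    ComputableRatSeq fun m => ∑ i ∈ range m, f i :=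
  (ComputableRatSeq.const 1).recurrence hf fun m => by rw [Finset.sum_range_succ]; ring

theorem ComputableRatSeq.const_add_natCast (c : ℚ) : ComputableRatSeq fun m => c + m :=
  (ComputableRatSeq.const c).add .natCast

theorem ComputableRatSeq.inv_add_natCast {c : ℚ} (hc : 0 < c) :
    ComputableRatSeq fun m => (c + m)⁻¹ :=
  (ComputableRatSeq.const_add_natCast c).inv fun m => by positivity

/-- All eight families have values of the form C R(L + Q), with only R and Q depending on m. The
coefficients are then R(sQ + r₀) and R r₁. -/
theorem FamilyInRatSpan.of_product {f : ℕ → ℝ → ℝ} {u : ℕ → ℕ → ℝ} {x y C L : ℝ} {R Q : ℕ → ℚ}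
    (hR : ComputableRatSeq R) (hQ : ComputableRatSeq Q) (s r₀ r₁ : ℚ) (hC : C = s * x)
    (hL : C * L = r₀ * x + r₁ * y)
    (h : ∀ m, IntegralEqSeriesEq (f m) (u m) (C * R m * (L + Q m))) : FamilyInRatSpan f u x y := by
  refine ⟨fun m => R m * (s * Q m + r₀), fun m => R m * r₁,
    hR.mul (((ComputableRatSeq.const s).mul hQ).add (.const r₀)), hR.mul (.const r₁), fun m => ?_⟩
  convert h m using 1
  push_cast
  linear_combination (-(R m : ℝ)) * hL - (R m : ℝ) * Q m * hC

/-! ### The two families of beta integrals of Legendre–Sun series -/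

/-- Growth factor in `m` of the integrals against `(1 - t) ^ (m - 1 / 2)`. -/
def ratioA (α β : ℚ) (m : ℕ) : ℚ :=
  ∏ i ∈ range m, (1 / 2 + i) * (1 / 2 + i) * ((1 / 2 + α + i)⁻¹ * (1 / 2 + β + i)⁻¹)

/-- Shift in `m` of the digamma values for the integrals against `(1 - t) ^ (m - 1 / 2)`. -/
def shiftA (α β : ℚ) (m : ℕ) : ℚ :=
  ∑ i ∈ range m, ((1 / 2 + α + i)⁻¹ + (1 / 2 + β + i)⁻¹ + -2 * (1 / 2 + i : ℚ)⁻¹)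

/-- Growth factor in `m` of the integrals against `(t (1 - t)) ^ (m - 1 / 2)`. -/
def ratioB (α β : ℚ) (m : ℕ) : ℚ :=
  ∏ i ∈ range m, 1 / 4 * ((1 / 2 + i) * (1 / 2 + i) * (((1 + α) / 2 + i)⁻¹ * ((1 + β) / 2 + i)⁻¹))

/-- Shift in `m` of the digamma values for the integrals against `(t (1 - t)) ^ (m - 1 / 2)`. -/
def shiftB (α β : ℚ) (m : ℕ) : ℚ :=
  ∑ i ∈ range m, (1 / 2 * (((1 + α) / 2 + i)⁻¹ + ((1 + β) / 2 + i)⁻¹) + -1 * (1 / 2 + i : ℚ)⁻¹)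

theorem computableRatSeq_ratioA {α β : ℚ} (hα : 0 < α) (hβ : 0 < β) :
    ComputableRatSeq (ratioA α β) :=
  (((ComputableRatSeq.const_add_natCast _).mul (.const_add_natCast _)).mul
    ((ComputableRatSeq.inv_add_natCast (by positivity)).mul
      (.inv_add_natCast (by positivity)))).prod_range

theorem computableRatSeq_shiftA {α β : ℚ} (hα : 0 < α) (hβ : 0 < β) :
    ComputableRatSeq (shiftA α β) :=
  (((ComputableRatSeq.inv_add_natCast (by positivity)).add (.inv_add_natCast (by positivity))).add
    ((ComputableRatSeq.const _).mul (.inv_add_natCast (by norm_num)))).sum_range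

theorem computableRatSeq_ratioB {α β : ℚ} (hα : 0 < α) (hβ : 0 < β) :
    ComputableRatSeq (ratioB α β) :=
  ((ComputableRatSeq.const _).mul (((ComputableRatSeq.const_add_natCast _).mul
    (.const_add_natCast _)).mul ((ComputableRatSeq.inv_add_natCast (by positivity)).mul
      (.inv_add_natCast (by positivity))))).prod_range

theorem computableRatSeq_shiftB {α β : ℚ} (hα : 0 < α) (hβ : 0 < β) :
    ComputableRatSeq (shiftB α β) :=
  (((ComputableRatSeq.const _).mul ((ComputableRatSeq.inv_add_natCast (by positivity)).add
    (.inv_add_natCast (by positivity)))).add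
    ((ComputableRatSeq.const _).mul (.inv_add_natCast (by norm_num)))).sum_range

theorem ratioA_cast (α β : ℚ) (m : ℕ) :
    (ratioA α β m : ℝ) =
      poch (1 / 2) m ^ 2 / (poch (1 / 2 + α) m * poch (1 / 2 + β) m) := by
  simp only [ratioA, poch, sq, ← prod_mul_distrib, ← prod_div_distrib]
  push_cast
  refine prod_congr rfl fun i _ => ?_
  rw [div_eq_mul_inv _ ((_ : ℝ) * _), mul_inv]

theorem ratioB_cast (α β : ℚ) (m : ℕ) :
    (ratioB α β m : ℝ) =
      poch (1 / 2) m ^ 2 / (4 ^ m * (poch ((1 + α) / 2) m * poch ((1 + β) / 2) m)) := by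
  rw [show (4 : ℝ) ^ m = ∏ i ∈ range m, (4 : ℝ) by simp]
  simp only [ratioB, poch, sq, ← prod_mul_distrib, ← prod_div_distrib]
  push_cast
  refine prod_congr rfl fun i _ => ?_
  rw [div_eq_mul_inv _ ((_ : ℝ) * _), mul_inv, mul_inv]
  ring

theorem shiftA_cast (α β : ℚ) (m : ℕ) :
    (shiftA α β m : ℝ) = pochLogDeriv (1 / 2 + α) m + pochLogDeriv (1 / 2 + β) m -
      2 * pochLogDeriv (1 / 2) m := by
  simp only [shiftA, pochLogDeriv, mul_sum, ← sum_add_distrib, ← sum_sub_distrib]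
  push_cast
  refine sum_congr rfl fun i _ => ?_
  simp only [one_div]
  ring

theorem shiftB_cast (α β : ℚ) (m : ℕ) :
    (shiftB α β m : ℝ) = (pochLogDeriv ((1 + α) / 2) m + pochLogDeriv ((1 + β) / 2) m) / 2 -
      pochLogDeriv (1 / 2) m := by
  simp only [shiftB, pochLogDeriv, sum_div, ← sum_add_distrib, ← sum_sub_distrib]
  push_cast
  refine sum_congr rfl fun i _ => ?_
  simp only [one_div]
  ring

/-- The value at `m = 0` of the Gamma factor for the weights `(1 - t) ^ (m - 1 / 2)`. -/
noncomputable def gammaFactorA (a b : ℝ) : ℝ :=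
  Real.pi / (Real.Gamma (1 / 2 + a) * Real.Gamma (1 / 2 + b))

/-- The value at `m = 0` of the digamma term for the weights `(1 - t) ^ (m - 1 / 2)`. -/
noncomputable def digammaTermA (a b : ℝ) : ℝ := psi (1 / 2 + a) + psi (1 / 2 + b) - 2 * psi (1 / 2)

/-- The value at `m = 0` of the Gamma factor for the weights `(t (1 - t)) ^ (m - 1 / 2)`. -/
noncomputable def gammaFactorB (a b : ℝ) : ℝ :=
  Real.pi / (Real.Gamma ((1 + a) / 2) * Real.Gamma ((1 + b) / 2)) ^ 2

/-- At q = 1/2 + m the functional equations of Γ and ψ split off the shift by m: the Gamma quotient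
acquires the rational factor `ratioA` and the digamma term the rational summand `shiftA`. -/
theorem integralEqSeriesEq_legendreSun_A {α β : ℚ} {a b : ℝ} (hα : (α : ℝ) = a) (hβ : (β : ℝ) = b)
    (ha : 1 / 16 < a) (hb : 1 / 16 < b) (hab : a + b = 1) {S : ℝ → ℝ} {u : ℕ → ℕ → ℝ}
    (hS : ∀ t ∈ Set.Ioo (0 : ℝ) 1, S t = ∑' k, lsCoeff 0 a b k * t ^ k)
    (hu : ∀ m k, u m k = lsCoeff 0 a b k * (2 * 4 ^ k / ((2 * k).choose k : ℝ) * dfRatioA m k))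
    (m : ℕ) :
    IntegralEqSeriesEq (fun t => S t / (1 - t) ^ ((1 : ℝ) / 2 - m)) (u m)
      (gammaFactorA a b * ratioA α β m * (digammaTermA a b + shiftA α β m)) := by
  have ha0 : 0 < a := by linarith
  have hb0 : 0 < b := by linarith
  have hq : (1 : ℝ) / 2 ≤ 1 / 2 + m := by simp
  have hsum := hasSum_lsCoeff_zero ha hb hab hq
  have hval : Real.Gamma (1 / 2 + m) ^ 2 / (Real.Gamma (1 / 2 + m + a) *
      Real.Gamma (1 / 2 + m + b)) * (psi (1 / 2 + m + a) + psi (1 / 2 + m + b) -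
        2 * psi (1 / 2 + m)) =
      gammaFactorA a b * ratioA α β m * (digammaTermA a b + shiftA α β m) := by
    have h1 := poch_pos (show 0 < 1 / 2 + a by positivity) m
    have h2 := poch_pos (show 0 < 1 / 2 + b by positivity) m
    have h3 := Real.Gamma_pos_of_pos (show 0 < 1 / 2 + a by positivity)
    have h4 := Real.Gamma_pos_of_pos (show 0 < 1 / 2 + b by positivity)
    rw [ratioA_cast, shiftA_cast, hα, hβ, gammaFactorA, digammaTermA, add_right_comm,
      add_right_comm (1 / 2 : ℝ) (m : ℝ) b, Gamma_add_natCast (by positivity),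
      Gamma_add_natCast (by positivity), Gamma_add_natCast (by positivity),
      psi_add_natCast (by positivity), psi_add_natCast (by positivity),
      psi_add_natCast (by positivity), Real.Gamma_one_half_eq, mul_pow, Real.sq_sqrt Real.pi_pos.le]
    field_simp
    ring
  rw [← hval, ← one_mul (Real.Gamma (1 / 2 + m) ^ 2 / _ * _)]
  refine integralEqSeriesEq_of_hasSum zero_le_one ha0 hb0 hab one_pos
    (lt_of_lt_of_le one_half_pos hq) one_pos hsum (fun t ht => ?_) fun k => ?_
  · have : 0 < 1 - t := by linarith [ht.2]
    rw [hS t ht, sub_self, Real.rpow_zero, one_mul, one_mul, div_eq_mul_inv,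
      ← Real.rpow_neg this.le]
    congr 2
    ring
  · rw [hu, beta_one_add, one_mul]

/-- Since 1/2 + m + a/2 = (1+a)/2 + m, the digamma values at (1+a)/2 and (1+b)/2 cancel up to
rational sums. What remains is ψ(1) - ψ(1/2) = 2 log 2, independently of a and b. -/
theorem integralEqSeriesEq_legendreSun_B {α β : ℚ} {a b : ℝ} (hα : (α : ℝ) = a) (hβ : (β : ℝ) = b)
    (ha : 1 / 16 < a) (hb : 1 / 16 < b) (hab : a + b = 1) {S : ℝ → ℝ} {u : ℕ → ℕ → ℝ}
    (hS : ∀ t ∈ Set.Ioo (0 : ℝ) 1, S t = ∑' k, lsCoeff 1 a b k * t ^ k)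
    (hu : ∀ m k, u m k =
      lsCoeff 1 a b k * (((2 * k).choose k : ℝ) / 2 ^ (2 * k + 3 * m) * dfRatioB m k)) (m : ℕ) :
    IntegralEqSeriesEq (fun t => S t / (Real.pi * (t * (1 - t)) ^ ((1 : ℝ) / 2 - m))) (u m)
      (gammaFactorB a b * ratioB α β m * (2 * Real.log 2 + shiftB α β m)) := by
  have ha0 : 0 < a := by linarith
  have hb0 : 0 < b := by linarith
  have hq : (1 : ℝ) / 2 ≤ 1 / 2 + m := by simp
  have hsum := hasSum_lsCoeff_one ha hb hab hq
  have hpi := Real.pi_pos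
  rw [show 1 / 2 + m + a / 2 = (1 + a) / 2 + m by ring,
    show 1 / 2 + m + b / 2 = (1 + b) / 2 + m by ring,
    show (1 : ℝ) / 2 + m + 1 / 2 = 1 + m by ring,
    show 2 * ((1 : ℝ) / 2 + m) = 1 + ((2 * m : ℕ) : ℝ) by push_cast; ring,
    Gamma_add_natCast one_pos, Gamma_add_natCast one_pos, poch_one, poch_one, factorial_two_mul,
    Real.Gamma_one, psi_add_natCast (by positivity), psi_add_natCast (by positivity),
    psi_add_natCast (by positivity), Gamma_add_natCast (by positivity),
    Gamma_add_natCast (by positivity), Gamma_add_natCast (by positivity),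
    Real.Gamma_one_half_eq, psi_one, psi_half] at hsum
  have h0 := poch_pos (show (0 : ℝ) < 1 / 2 by positivity) m
  have h1 := poch_pos (show 0 < (1 + a) / 2 by positivity) m
  have h2 := poch_pos (show 0 < (1 + b) / 2 by positivity) m
  have h3 := Real.Gamma_pos_of_pos (show 0 < (1 + a) / 2 by positivity)
  have h4 := Real.Gamma_pos_of_pos (show 0 < (1 + b) / 2 by positivity)
  have h5 : (0 : ℝ) < m ! := by positivity
  have hval := integralEqSeriesEq_of_hasSum
    (f := fun t => S t / (Real.pi * (t * (1 - t)) ^ ((1 : ℝ) / 2 - m))) (u := u m)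
    (C := 1 / Real.pi) le_rfl ha0 hb0 hab
    (lt_of_lt_of_le one_half_pos hq) (lt_of_lt_of_le one_half_pos hq) (by positivity) hsum
    (fun t ht => ?_) fun k => ?_
  · convert hval using 1
    rw [ratioB_cast, shiftB_cast, hα, hβ, gammaFactorB]
    -- Three factors √π come from Γ(1/2 + m) and one from Watson's formula.
    have hs : √Real.pi ^ 4 = Real.pi ^ 2 := by
      rw [show 4 = 2 * 2 by norm_num, pow_mul, Real.sq_sqrt hpi.le]
    have hs0 : 0 < √Real.pi := by positivity
    generalize Real.Gamma ((1 + a) / 2) = X1 at *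
    generalize Real.Gamma ((1 + b) / 2) = X2 at *
    generalize poch ((1 + a) / 2) m = X3 at *
    generalize poch ((1 + b) / 2) m = X4 at *
    generalize poch (1 / 2) m = X5 at *
    field_simp
    rw [hs]
    ring
  · have h1t : 0 < 1 - t := by linarith [ht.2]
    rw [hS t ht, Real.mul_rpow ht.1.le h1t.le, show (1 : ℝ) / 2 - m = -(1 / 2 + m - 1) by ring,
      Real.rpow_neg ht.1.le, Real.rpow_neg h1t.le]
    have := ht.1
    have : 0 < t ^ ((1 : ℝ) / 2 + m - 1) := by positivity
    have : 0 < (1 - t) ^ ((1 : ℝ) / 2 + m - 1) := by positivity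
    field_simp
  · rw [hu, ← beta_half_add]
    ring

theorem dfRatioA_zero (k : ℕ) : dfRatioA 0 k = 1 / (2 * k + 1) := by
  have h := doubleFactorial_two_mul_sub_one (k + 1)
  rw [poch_succ, show 2 * (k + 1) - 1 = 2 * k + 2 * 0 + 1 by omega] at h
  have := poch_pos (show (0 : ℝ) < 1 / 2 by norm_num) k
  rw [dfRatioA, h, doubleFactorial_two_mul_sub_one]
  simp only [mul_zero, zero_tsub, Nat.doubleFactorial, Nat.cast_one, mul_one]
  rw [pow_succ]
  field_simp
  ring

theorem dfRatioB_zero (k : ℕ) : dfRatioB 0 k = 1 := by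
  have := poch_pos (show (0 : ℝ) < 1 / 2 by norm_num) k
  have h : ((2 * k - 1)‼ : ℝ) ≠ 0 := by
    rw [doubleFactorial_two_mul_sub_one]
    positivity
  simp [dfRatioB, h]

theorem IntegralEqSeriesEq.of_eq {f g : ℝ → ℝ} {u w : ℕ → ℝ} {v v' : ℝ}
    (h : IntegralEqSeriesEq f u v) (hf : ∀ t, g t = f t) (hu : ∀ k, w k = u k) (hv : v' = v) :
    IntegralEqSeriesEq g w v' := by
  rw [funext hf, funext hu, hv]
  exact h

theorem IntegralEqSeriesEq.explicit_A {α β : ℚ} {a b v : ℝ} {S : ℝ → ℝ} {u : ℕ → ℕ → ℝ}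
    {w : ℕ → ℝ}
    (h : ∀ m : ℕ, IntegralEqSeriesEq (fun t => S t / (1 - t) ^ ((1 : ℝ) / 2 - m)) (u m)
      (gammaFactorA a b * ratioA α β m * (digammaTermA a b + shiftA α β m)))
    (hw : ∀ k, w k = u 0 k) (hv : v = gammaFactorA a b * digammaTermA a b) :
    IntegralEqSeriesEq (fun t => S t / √(1 - t)) w v :=
  (h 0).of_eq (fun t => by rw [Real.sqrt_eq_rpow, Nat.cast_zero, sub_zero]) hw
    (by simp [hv, ratioA, shiftA])

theorem IntegralEqSeriesEq.explicit_B {α β : ℚ} {a b v : ℝ} {S : ℝ → ℝ} {u : ℕ → ℕ → ℝ}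
    {w : ℕ → ℝ}
    (h : ∀ m : ℕ, IntegralEqSeriesEq
      (fun t => S t / (Real.pi * (t * (1 - t)) ^ ((1 : ℝ) / 2 - m))) (u m)
      (gammaFactorB a b * ratioB α β m * (2 * Real.log 2 + shiftB α β m)))
    (hw : ∀ k, w k = u 0 k) (hv : v = gammaFactorB a b * (2 * Real.log 2)) :
    IntegralEqSeriesEq (fun t => S t / (Real.pi * √(t * (1 - t)))) w v :=
  (h 0).of_eq (fun t => by rw [Real.sqrt_eq_rpow, Nat.cast_zero, sub_zero]) hw
    (by simp [hv, ratioB, shiftB])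

/-! ### The degrees `-1/2`, `-1/3`, `-1/4`, `-1/6` -/

/-- Both series converge separately inside the unit disc, so their sum may be merged termwise into
the s = 1 coefficients. -/
theorem tsum_add_eq_lsCoeff_one {a b : ℝ} (ha : 0 < a) (hb : 0 < b) (hab : a + b = 1)
    {T T' : ℕ → ℝ} {t : ℝ} (ht : |t| < 1) (hT : ∀ k, T k = lsCoeff 0 a b k * t ^ k)
    (hT' : ∀ k, T' k = -(hypCoeff a b 1 k * harm k * t ^ k)) :
    (Summable T ∧ Summable T') ∧ ∑' k, T k + ∑' k, T' k = ∑' k, lsCoeff 1 a b k * t ^ k := by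
  have h1 : Summable T := by
    have h := (isBigO_pochLogDeriv ha one_pos).add (isBigO_pochLogDeriv hb one_pos)
    rw [funext hT]
    simpa [lsCoeff] using summable_hypCoeff_mul_pow ha hb hab h ht
  have h2 : Summable T' := by
    rw [funext hT']
    exact (summable_hypCoeff_mul_pow ha hb hab isBigO_harm ht).neg
  refine ⟨⟨h1, h2⟩, ?_⟩
  rw [← h1.tsum_add h2]
  refine tsum_congr fun k => ?_
  rw [hT, hT', lsCoeff, lsCoeff]
  ring

theorem abs_lt_one_of_mem_Ioo {t : ℝ} (ht : t ∈ Set.Ioo (0 : ℝ) 1) : |t| < 1 := by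
  rw [abs_lt]
  exact ⟨by linarith [ht.1], ht.2⟩

theorem hypCoeff_half (k : ℕ) :
    hypCoeff (1 / 2) (1 / 2) 1 k = ((2 * k).choose k : ℝ) ^ 2 / 16 ^ k := by
  have : (0 : ℝ) < k ! := by positivity
  rw [hypCoeff, poch_one, choose_two_mul, factorial_two_mul,
    show (16 : ℝ) ^ k = 4 ^ k * 4 ^ k by rw [← mul_pow]; norm_num]
  field_simp

theorem hypCoeff_third (k : ℕ) :
    hypCoeff (1 / 3) (2 / 3) 1 k =
      ((2 * k).choose k : ℝ) * ((3 * k).choose k : ℝ) / 27 ^ k := by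
  have : (0 : ℝ) < k ! := by positivity
  have : (0 : ℝ) < (2 * k)! := by positivity
  rw [hypCoeff, poch_one, choose_two_mul, choose_three_mul, factorial_three_mul]
  field_simp

theorem hypCoeff_quarter (k : ℕ) :
    hypCoeff (1 / 4) (3 / 4) 1 k =
      ((2 * k).choose k : ℝ) * ((4 * k).choose (2 * k) : ℝ) / 64 ^ k := by
  have : (0 : ℝ) < k ! := by positivity
  have : (0 : ℝ) < (2 * k)! := by positivity
  rw [hypCoeff, poch_one, choose_two_mul, choose_four_mul, factorial_four_mul]
  field_simp

theorem hypCoeff_sixth (k : ℕ) :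
    hypCoeff (1 / 6) (5 / 6) 1 k =
      ((3 * k).choose k : ℝ) * ((6 * k).choose (3 * k) : ℝ) / 432 ^ k := by
  have : (0 : ℝ) < k ! := by positivity
  have : (0 : ℝ) < (2 * k)! := by positivity
  have : (0 : ℝ) < (3 * k)! := by positivity
  have h := factorial_six_mul k
  rw [hypCoeff, poch_one, choose_three_mul, choose_six_mul,
    show ((6 * k)! : ℝ) = 432 ^ k * (poch (1 / 6) k * poch (5 / 6) k) * (3 * k)! * (2 * k)! / (k ! : ℝ)
      by rw [eq_div_iff (by positivity), h]]
  field_simp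

theorem lsTerm2_eq (t : ℝ) (k : ℕ) : lsTerm2 t k = lsCoeff 0 (1 / 2) (1 / 2) k * t ^ k := by
  rw [lsTerm2, lsCoeff, hypCoeff_half, pochLogDeriv_half, div_pow]
  norm_num
  ring

theorem lsTerm3_eq (t : ℝ) (k : ℕ) : lsTerm3 t k = lsCoeff 0 (1 / 3) (2 / 3) k * t ^ k := by
  rw [lsTerm3, lsCoeff, hypCoeff_third, pochLogDeriv_third, div_pow]
  norm_num
  ring

theorem lsTerm4_eq (t : ℝ) (k : ℕ) : lsTerm4 t k = lsCoeff 0 (1 / 4) (3 / 4) k * t ^ k := by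
  rw [lsTerm4, lsCoeff, hypCoeff_quarter, pochLogDeriv_quarter, div_pow]
  norm_num
  ring

theorem lsTerm6_eq (t : ℝ) (k : ℕ) : lsTerm6 t k = lsCoeff 0 (1 / 6) (5 / 6) k * t ^ k := by
  rw [lsTerm6, lsCoeff, hypCoeff_sixth, pochLogDeriv_sixth, div_pow]
  norm_num
  ring

theorem lsTildeTerm2_eq (t : ℝ) (k : ℕ) :
    lsTildeTerm2 t k = -(hypCoeff (1 / 2) (1 / 2) 1 k * harm k * t ^ k) := by
  rw [lsTildeTerm2, hypCoeff_half, div_pow]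
  norm_num
  ring

theorem lsTildeTerm3_eq (t : ℝ) (k : ℕ) :
    lsTildeTerm3 t k = -(hypCoeff (1 / 3) (2 / 3) 1 k * harm k * t ^ k) := by
  rw [lsTildeTerm3, hypCoeff_third, div_pow]
  norm_num
  ring

theorem lsTildeTerm4_eq (t : ℝ) (k : ℕ) :
    lsTildeTerm4 t k = -(hypCoeff (1 / 4) (3 / 4) 1 k * harm k * t ^ k) := by
  rw [lsTildeTerm4, hypCoeff_quarter, div_pow]
  norm_num
  ring

theorem lsTildeTerm6_eq (t : ℝ) (k : ℕ) :
    lsTildeTerm6 t k = -(hypCoeff (1 / 6) (5 / 6) 1 k * harm k * t ^ k) := by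
  rw [lsTildeTerm6, hypCoeff_sixth, div_pow]
  norm_num
  ring

theorem ls2_add {t : ℝ} (ht : |t| < 1) :
    (Summable (lsTerm2 t) ∧ Summable (lsTildeTerm2 t)) ∧
      ls2 t + lsTilde2 t = ∑' k, lsCoeff 1 (1 / 2) (1 / 2) k * t ^ k :=
  tsum_add_eq_lsCoeff_one (by norm_num) (by norm_num) (by norm_num) ht (lsTerm2_eq t)
    (lsTildeTerm2_eq t)

theorem ls3_add {t : ℝ} (ht : |t| < 1) :
    (Summable (lsTerm3 t) ∧ Summable (lsTildeTerm3 t)) ∧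
      ls3 t + lsTilde3 t = ∑' k, lsCoeff 1 (1 / 3) (2 / 3) k * t ^ k :=
  tsum_add_eq_lsCoeff_one (by norm_num) (by norm_num) (by norm_num) ht (lsTerm3_eq t)
    (lsTildeTerm3_eq t)

theorem ls4_add {t : ℝ} (ht : |t| < 1) :
    (Summable (lsTerm4 t) ∧ Summable (lsTildeTerm4 t)) ∧
      ls4 t + lsTilde4 t = ∑' k, lsCoeff 1 (1 / 4) (3 / 4) k * t ^ k :=
  tsum_add_eq_lsCoeff_one (by norm_num) (by norm_num) (by norm_num) ht (lsTerm4_eq t)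
    (lsTildeTerm4_eq t)

theorem ls6_add {t : ℝ} (ht : |t| < 1) :
    (Summable (lsTerm6 t) ∧ Summable (lsTildeTerm6 t)) ∧
      ls6 t + lsTilde6 t = ∑' k, lsCoeff 1 (1 / 6) (5 / 6) k * t ^ k :=
  tsum_add_eq_lsCoeff_one (by norm_num) (by norm_num) (by norm_num) ht (lsTerm6_eq t)
    (lsTildeTerm6_eq t)

theorem choose_two_mul_ne_zero (k : ℕ) : ((2 * k).choose k : ℝ) ≠ 0 := by
  exact_mod_cast (Nat.choose_pos (by omega : k ≤ 2 * k)).ne'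

/-- The beta weight 4^k / binom(2k, k) removes one central binomial coefficient from the squared
one. The constant 4 is the 2 of the beta weight times the 2 from the equal parameters a = b. -/
theorem ls2_family_A (m : ℕ) :
    IntegralEqSeriesEq (fun t => ls2 t / (1 - t) ^ ((1 : ℝ) / 2 - m))
      (fun k => 4 * (((2 * k).choose k : ℝ) / 2 ^ (2 * k) *
          ((2 * harm (2 * k) - harm k) * dfRatioA m k)))
      (gammaFactorA (1 / 2) (1 / 2) * ratioA (1 / 2) (1 / 2) m *
        (digammaTermA (1 / 2) (1 / 2) + shiftA (1 / 2) (1 / 2) m)) := by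
  refine integralEqSeriesEq_legendreSun_A (by norm_num) (by norm_num) (by norm_num) (by norm_num)
    (by norm_num) (fun t _ => tsum_congr (lsTerm2_eq t)) (u := fun m k => 4 * (((2 * k).choose k : ℝ) / 2 ^ (2 * k) *
          ((2 * harm (2 * k) - harm k) * dfRatioA m k))) (fun m k => ?_) m
  have := choose_two_mul_ne_zero k
  rw [lsCoeff, hypCoeff_half, pochLogDeriv_half, pow_mul,
    show (16 : ℝ) = 4 * 4 by norm_num, mul_pow, show (2 : ℝ) ^ 2 = 4 by norm_num]
  field_simp
  ring

theorem ls3_family_A (m : ℕ) :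
    IntegralEqSeriesEq (fun t => ls3 t / (1 - t) ^ ((1 : ℝ) / 2 - m))
      (fun k => 2 * (2 ^ (2 * k) * ((3 * k).choose k : ℝ) / 3 ^ (3 * k) *
          ((3 * harm (3 * k) - harm k) * dfRatioA m k)))
      (gammaFactorA (1 / 3) (2 / 3) * ratioA (1 / 3) (2 / 3) m *
        (digammaTermA (1 / 3) (2 / 3) + shiftA (1 / 3) (2 / 3) m)) := by
  refine integralEqSeriesEq_legendreSun_A (by norm_num) (by norm_num) (by norm_num) (by norm_num)
    (by norm_num) (fun t _ => tsum_congr (lsTerm3_eq t)) (u := fun m k =>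
      2 * (2 ^ (2 * k) * ((3 * k).choose k : ℝ) / 3 ^ (3 * k) *
          ((3 * harm (3 * k) - harm k) * dfRatioA m k))) (fun m k => ?_) m
  have := choose_two_mul_ne_zero k
  rw [lsCoeff, hypCoeff_third, pochLogDeriv_third, pow_mul, pow_mul,
    show (3 : ℝ) ^ 3 = 27 by norm_num, show (2 : ℝ) ^ 2 = 4 by norm_num]
  field_simp
  ring

theorem ls4_family_A (m : ℕ) :
    IntegralEqSeriesEq (fun t => ls4 t / (1 - t) ^ ((1 : ℝ) / 2 - m))
      (fun k => 4 * (((4 * k).choose (2 * k) : ℝ) / 2 ^ (4 * k) *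
          ((2 * harm (4 * k) - harm (2 * k)) * dfRatioA m k)))
      (gammaFactorA (1 / 4) (3 / 4) * ratioA (1 / 4) (3 / 4) m *
        (digammaTermA (1 / 4) (3 / 4) + shiftA (1 / 4) (3 / 4) m)) := by
  refine integralEqSeriesEq_legendreSun_A (by norm_num) (by norm_num) (by norm_num) (by norm_num)
    (by norm_num) (fun t _ => tsum_congr (lsTerm4_eq t)) (u := fun m k =>
      4 * (((4 * k).choose (2 * k) : ℝ) / 2 ^ (4 * k) *
          ((2 * harm (4 * k) - harm (2 * k)) * dfRatioA m k))) (fun m k => ?_) m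
  have := choose_two_mul_ne_zero k
  rw [lsCoeff, hypCoeff_quarter, pochLogDeriv_quarter, pow_mul,
    show (64 : ℝ) = 16 * 4 by norm_num, mul_pow, show (2 : ℝ) ^ 4 = 16 by norm_num]
  field_simp
  ring

theorem ls6_family_A (m : ℕ) :
    IntegralEqSeriesEq (fun t => ls6 t / (1 - t) ^ ((1 : ℝ) / 2 - m))
      (fun k => 2 * (((6 * k).choose (3 * k) : ℝ) * ((3 * k).choose k : ℝ) /
            ((2 ^ 2 * 3 ^ 3) ^ k * ((2 * k).choose k : ℝ)) *
          ((6 * harm (6 * k) - 3 * harm (3 * k) - 2 * harm (2 * k) + harm k) * dfRatioA m k)))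
      (gammaFactorA (1 / 6) (5 / 6) * ratioA (1 / 6) (5 / 6) m *
        (digammaTermA (1 / 6) (5 / 6) + shiftA (1 / 6) (5 / 6) m)) := by
  refine integralEqSeriesEq_legendreSun_A (by norm_num) (by norm_num) (by norm_num) (by norm_num)
    (by norm_num) (fun t _ => tsum_congr (lsTerm6_eq t)) (u := fun m k =>
      2 * (((6 * k).choose (3 * k) : ℝ) * ((3 * k).choose k : ℝ) /
            ((2 ^ 2 * 3 ^ 3) ^ k * ((2 * k).choose k : ℝ)) *
          ((6 * harm (6 * k) - 3 * harm (3 * k) - 2 * harm (2 * k) + harm k) * dfRatioA m k)))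
    (fun m k => ?_) m
  have := choose_two_mul_ne_zero k
  rw [lsCoeff, hypCoeff_sixth, pochLogDeriv_sixth, show (432 : ℝ) = 4 * 108 by norm_num, mul_pow 4 108,
    show (2 : ℝ) ^ 2 * 3 ^ 3 = 108 by norm_num]
  field_simp
  ring

theorem ls2_family_B (m : ℕ) :
    IntegralEqSeriesEq
      (fun t => (ls2 t + lsTilde2 t) / (Real.pi * (t * (1 - t)) ^ ((1 : ℝ) / 2 - m)))
      (fun k => ((2 * k).choose k : ℝ) ^ 3 / 2 ^ (6 * k + 3 * m) *
          ((4 * harm (2 * k) - 3 * harm k) * dfRatioB m k))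
      (gammaFactorB (1 / 2) (1 / 2) * ratioB (1 / 2) (1 / 2) m *
        (2 * Real.log 2 + shiftB (1 / 2) (1 / 2) m)) := by
  refine integralEqSeriesEq_legendreSun_B (by norm_num) (by norm_num) (by norm_num) (by norm_num)
    (by norm_num) (S := fun t => ls2 t + lsTilde2 t)
    (fun t ht => (ls2_add (abs_lt_one_of_mem_Ioo ht)).2) (u := fun m k =>
      ((2 * k).choose k : ℝ) ^ 3 / 2 ^ (6 * k + 3 * m) *
          ((4 * harm (2 * k) - 3 * harm k) * dfRatioB m k)) (fun m k => ?_) m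
  rw [lsCoeff, hypCoeff_half, pochLogDeriv_half, show 6 * k + 3 * m = 4 * k + (2 * k + 3 * m) by ring,
    pow_add, pow_mul 2 4, show (2 : ℝ) ^ 4 = 16 by norm_num]
  field_simp
  ring

theorem ls3_family_B (m : ℕ) :
    IntegralEqSeriesEq
      (fun t => (ls3 t + lsTilde3 t) / (Real.pi * (t * (1 - t)) ^ ((1 : ℝ) / 2 - m)))
      (fun k => ((2 * k).choose k : ℝ) ^ 2 * ((3 * k).choose k : ℝ) /
            (2 ^ (2 * k + 3 * m) * 3 ^ (3 * k)) *
          ((3 * harm (3 * k) - 2 * harm k) * dfRatioB m k))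
      (gammaFactorB (1 / 3) (2 / 3) * ratioB (1 / 3) (2 / 3) m *
        (2 * Real.log 2 + shiftB (1 / 3) (2 / 3) m)) := by
  refine integralEqSeriesEq_legendreSun_B (by norm_num) (by norm_num) (by norm_num) (by norm_num)
    (by norm_num) (S := fun t => ls3 t + lsTilde3 t)
    (fun t ht => (ls3_add (abs_lt_one_of_mem_Ioo ht)).2) (u := fun m k =>
      ((2 * k).choose k : ℝ) ^ 2 * ((3 * k).choose k : ℝ) /
            (2 ^ (2 * k + 3 * m) * 3 ^ (3 * k)) *
          ((3 * harm (3 * k) - 2 * harm k) * dfRatioB m k)) (fun m k => ?_) m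
  rw [lsCoeff, hypCoeff_third, pochLogDeriv_third, pow_mul 3 3, show (3 : ℝ) ^ 3 = 27 by norm_num]
  field_simp
  ring

theorem ls4_family_B (m : ℕ) :
    IntegralEqSeriesEq
      (fun t => (ls4 t + lsTilde4 t) / (Real.pi * (t * (1 - t)) ^ ((1 : ℝ) / 2 - m)))
      (fun k => ((2 * k).choose k : ℝ) ^ 2 * ((4 * k).choose (2 * k) : ℝ) /
            2 ^ (8 * k + 3 * m) *
          ((4 * harm (4 * k) - 2 * harm (2 * k) - harm k) * dfRatioB m k))
      (gammaFactorB (1 / 4) (3 / 4) * ratioB (1 / 4) (3 / 4) m *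
        (2 * Real.log 2 + shiftB (1 / 4) (3 / 4) m)) := by
  refine integralEqSeriesEq_legendreSun_B (by norm_num) (by norm_num) (by norm_num) (by norm_num)
    (by norm_num) (S := fun t => ls4 t + lsTilde4 t)
    (fun t ht => (ls4_add (abs_lt_one_of_mem_Ioo ht)).2) (u := fun m k =>
      ((2 * k).choose k : ℝ) ^ 2 * ((4 * k).choose (2 * k) : ℝ) /
            2 ^ (8 * k + 3 * m) *
          ((4 * harm (4 * k) - 2 * harm (2 * k) - harm k) * dfRatioB m k)) (fun m k => ?_) m
  rw [lsCoeff, hypCoeff_quarter, pochLogDeriv_quarter,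
    show 8 * k + 3 * m = 6 * k + (2 * k + 3 * m) by ring,
    pow_add, pow_mul 2 6, show (2 : ℝ) ^ 6 = 64 by norm_num]
  field_simp

theorem ls6_family_B (m : ℕ) :
    IntegralEqSeriesEq
      (fun t => (ls6 t + lsTilde6 t) / (Real.pi * (t * (1 - t)) ^ ((1 : ℝ) / 2 - m)))
      (fun k => ((2 * k).choose k : ℝ) * ((3 * k).choose k : ℝ) *
            ((6 * k).choose (3 * k) : ℝ) / (2 ^ (6 * k + 3 * m) * 3 ^ (3 * k)) *
          ((6 * harm (6 * k) - 3 * harm (3 * k) - 2 * harm (2 * k)) * dfRatioB m k))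
      (gammaFactorB (1 / 6) (5 / 6) * ratioB (1 / 6) (5 / 6) m *
        (2 * Real.log 2 + shiftB (1 / 6) (5 / 6) m)) := by
  refine integralEqSeriesEq_legendreSun_B (by norm_num) (by norm_num) (by norm_num) (by norm_num)
    (by norm_num) (S := fun t => ls6 t + lsTilde6 t)
    (fun t ht => (ls6_add (abs_lt_one_of_mem_Ioo ht)).2) (u := fun m k =>
      ((2 * k).choose k : ℝ) * ((3 * k).choose k : ℝ) *
            ((6 * k).choose (3 * k) : ℝ) / (2 ^ (6 * k + 3 * m) * 3 ^ (3 * k)) *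
          ((6 * harm (6 * k) - 3 * harm (3 * k) - 2 * harm (2 * k)) * dfRatioB m k))
    (fun m k => ?_) m
  rw [lsCoeff, hypCoeff_sixth, pochLogDeriv_sixth,
    show 6 * k + 3 * m = 4 * k + (2 * k + 3 * m) by ring,
    pow_add, pow_mul 2 4, pow_mul 3 3, show (432 : ℝ) = 2 ^ 4 * 3 ^ 3 by norm_num, mul_pow]
  field_simp
  ring

/-! ### Gamma factors and digamma terms -/

theorem gammaFactorA_half : gammaFactorA (1 / 2) (1 / 2) = Real.pi := by
  norm_num [gammaFactorA]

theorem digammaTermA_half : digammaTermA (1 / 2) (1 / 2) = 4 * Real.log 2 := by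
  rw [digammaTermA, show (1 : ℝ) / 2 + 1 / 2 = 1 by norm_num, psi_one, psi_half]
  ring

/-- The Gamma factor via the reflection formula. -/
theorem gammaFactorA_eq {c : ℝ} (hc : 0 < c) :
    gammaFactorA (1 / 2 - c) (1 / 2 + c) = Real.sin (Real.pi * c) / c := by
  have h := Real.Gamma_mul_Gamma_one_sub c
  rw [gammaFactorA, show 1 / 2 + (1 / 2 - c) = 1 - c by ring,
    show 1 / 2 + (1 / 2 + c) = c + 1 by ring, Real.Gamma_add_one hc.ne']
  have h2 : Real.Gamma (1 - c) * (c * Real.Gamma c) = c * (Real.pi / Real.sin (Real.pi * c)) := by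
    rw [← h]
    ring
  rw [h2]
  have := Real.pi_pos
  field_simp

/-- With c = 1/2 - a the term becomes a symmetric sum at c. Thus degree -1/3 uses the digamma values
at sixths and degree -1/6 those at thirds, while -1/4 uses quarters. -/
theorem digammaTermA_eq {c : ℝ} (hc : 0 < c) :
    digammaTermA (1 / 2 - c) (1 / 2 + c) = psi c + psi (1 - c) + 1 / c - 2 * psi (1 / 2) := by
  rw [digammaTermA, show 1 / 2 + (1 / 2 - c) = 1 - c by ring,
    show 1 / 2 + (1 / 2 + c) = c + 1 by ring, psi_add_one hc]
  ring

theorem gammaFactorA_third : gammaFactorA (1 / 3) (2 / 3) = 3 := by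
  have h := gammaFactorA_eq (c := 1 / 6) (by norm_num)
  norm_num [show Real.pi * (1 / 6) = Real.pi / 6 by ring] at h ⊢
  exact h

theorem digammaTermA_third : digammaTermA (1 / 3) (2 / 3) = 6 - 3 * Real.log 3 := by
  have h := digammaTermA_eq (c := 1 / 6) (by norm_num)
  rw [show (1 : ℝ) / 2 - 1 / 6 = 1 / 3 by norm_num, show (1 : ℝ) / 2 + 1 / 6 = 2 / 3 by norm_num,
    show (1 : ℝ) - 1 / 6 = 5 / 6 by norm_num, psi_sixth, psi_half] at h
  rw [h]
  ring

theorem gammaFactorA_quarter : gammaFactorA (1 / 4) (3 / 4) = 2 * √2 := by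
  have h := gammaFactorA_eq (c := 1 / 4) (by norm_num)
  rw [show (1 : ℝ) / 2 - 1 / 4 = 1 / 4 by norm_num, show (1 : ℝ) / 2 + 1 / 4 = 3 / 4 by norm_num,
    show Real.pi * (1 / 4) = Real.pi / 4 by ring, Real.sin_pi_div_four] at h
  rw [h]
  ring

theorem digammaTermA_quarter : digammaTermA (1 / 4) (3 / 4) = 4 - 2 * Real.log 2 := by
  have h := digammaTermA_eq (c := 1 / 4) (by norm_num)
  rw [show (1 : ℝ) / 2 - 1 / 4 = 1 / 4 by norm_num, show (1 : ℝ) / 2 + 1 / 4 = 3 / 4 by norm_num,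
    show (1 : ℝ) - 1 / 4 = 3 / 4 by norm_num, psi_quarter, psi_half] at h
  rw [h]
  ring

theorem gammaFactorA_sixth : gammaFactorA (1 / 6) (5 / 6) = 3 * √3 / 2 := by
  have h := gammaFactorA_eq (c := 1 / 3) (by norm_num)
  rw [show (1 : ℝ) / 2 - 1 / 3 = 1 / 6 by norm_num, show (1 : ℝ) / 2 + 1 / 3 = 5 / 6 by norm_num,
    show Real.pi * (1 / 3) = Real.pi / 3 by ring, Real.sin_pi_div_three] at h
  rw [h]
  ring

theorem digammaTermA_sixth :
    digammaTermA (1 / 6) (5 / 6) = 3 + Real.log (2 ^ 4 / 3 ^ 3) := by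
  have h := digammaTermA_eq (c := 1 / 3) (by norm_num)
  rw [show (1 : ℝ) / 2 - 1 / 3 = 1 / 6 by norm_num, show (1 : ℝ) / 2 + 1 / 3 = 5 / 6 by norm_num,
    show (1 : ℝ) - 1 / 3 = 2 / 3 by norm_num, psi_third, psi_half] at h
  rw [h, Real.log_div (by norm_num) (by norm_num), Real.log_pow, Real.log_pow]
  push_cast
  ring

/-- Reflection at 1/4, raised to the fourth power, trades Γ(3/4) for Γ(1/4). -/
theorem gammaFactorB_half :
    gammaFactorB (1 / 2) (1 / 2) = 1 / 4 * (Real.Gamma (1 / 4) ^ 4 / Real.pi ^ 3) := by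
  have h := Real.Gamma_mul_Gamma_one_sub (1 / 4)
  rw [show Real.pi * (1 / 4) = Real.pi / 4 by ring, Real.sin_pi_div_four,
    show (1 : ℝ) - 1 / 4 = 3 / 4 by norm_num] at h
  have g1 := Real.Gamma_pos_of_pos (show (0 : ℝ) < 1 / 4 by norm_num)
  have g2 := Real.Gamma_pos_of_pos (show (0 : ℝ) < 3 / 4 by norm_num)
  have hpi := Real.pi_pos
  have h4 : Real.Gamma (1 / 4) ^ 4 * Real.Gamma (3 / 4) ^ 4 = 4 * Real.pi ^ 4 := by
    rw [← mul_pow, h, div_pow, div_pow, show √2 ^ 4 = (√2 ^ 2) ^ 2 by ring,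
      Real.sq_sqrt (by norm_num)]
    ring
  rw [gammaFactorB, show ((1 : ℝ) + 1 / 2) / 2 = 3 / 4 by norm_num]
  field_simp
  linear_combination -h4

/-- Reflection at 1/3 eliminates Γ(2/3), and duplication at 1/3 eliminates Γ(5/6); the latter
introduces the cube root of 2. -/
theorem gammaFactorB_third :
    gammaFactorB (1 / 3) (2 / 3) =
      9 / 32 * ((2 : ℝ) ^ ((1 : ℝ) / 3) * Real.Gamma (1 / 3) ^ 6 / Real.pi ^ 4) := by
  have h1 := Real.Gamma_mul_Gamma_one_sub (1 / 3)
  rw [show Real.pi * (1 / 3) = Real.pi / 3 by ring, Real.sin_pi_div_three,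
    show (1 : ℝ) - 1 / 3 = 2 / 3 by norm_num] at h1
  have h2 := Real.Gamma_mul_Gamma_add_half (1 / 3)
  rw [show (1 : ℝ) / 3 + 1 / 2 = 5 / 6 by norm_num, show (2 : ℝ) * (1 / 3) = 2 / 3 by norm_num,
    show (1 : ℝ) - 2 / 3 = 1 / 3 by norm_num] at h2
  rw [gammaFactorB, show ((1 : ℝ) + 1 / 3) / 2 = 2 / 3 by norm_num,
    show ((1 : ℝ) + 2 / 3) / 2 = 5 / 6 by norm_num]
  have g1 := Real.Gamma_pos_of_pos (show (0 : ℝ) < 1 / 3 by norm_num)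
  have g2 := Real.Gamma_pos_of_pos (show (0 : ℝ) < 2 / 3 by norm_num)
  have g3 := Real.Gamma_pos_of_pos (show (0 : ℝ) < 5 / 6 by norm_num)
  have hpi := Real.pi_pos
  have hc : ((2 : ℝ) ^ ((1 : ℝ) / 3)) ^ 3 = 2 := by
    rw [← Real.rpow_natCast, ← Real.rpow_mul (by norm_num)]
    norm_num
  have hc0 : 0 < (2 : ℝ) ^ ((1 : ℝ) / 3) := by positivity
  generalize Real.Gamma (1 / 3) = x at *
  generalize Real.Gamma (2 / 3) = y at *
  generalize Real.Gamma (5 / 6) = z at *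
  generalize (2 : ℝ) ^ ((1 : ℝ) / 3) = c at *
  have h1' : x ^ 4 * y ^ 4 = 16 * Real.pi ^ 4 / 9 := by
    rw [← mul_pow, h1, div_pow, div_pow, show √3 ^ 4 = (√3 ^ 2) ^ 2 by ring,
      Real.sq_sqrt (by norm_num)]
    ring
  have h2' : x ^ 2 * z ^ 2 = y ^ 2 * c ^ 2 * Real.pi := by
    rw [← mul_pow, h2, mul_pow, mul_pow, Real.sq_sqrt hpi.le]
  have h3 : x ^ 6 * (y * z) ^ 2 * c = 32 * Real.pi ^ 5 / 9 := by
    linear_combination (x ^ 4 * y ^ 2 * c) * h2' + (c ^ 3 * Real.pi) * h1' +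
      16 * Real.pi ^ 5 / 9 * hc
  field_simp
  linear_combination -9 * h3

theorem gammaFactorB_quarter : gammaFactorB (1 / 4) (3 / 4) =
    Real.pi / (Real.Gamma (5 / 8) * Real.Gamma (7 / 8)) ^ 2 := by
  rw [gammaFactorB, show ((1 : ℝ) + 1 / 4) / 2 = 5 / 8 by norm_num,
    show ((1 : ℝ) + 3 / 4) / 2 = 7 / 8 by norm_num]

theorem gammaFactorB_sixth : gammaFactorB (1 / 6) (5 / 6) =
    Real.pi / (Real.Gamma (7 / 12) * Real.Gamma (11 / 12)) ^ 2 := by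
  rw [gammaFactorB, show ((1 : ℝ) + 1 / 6) / 2 = 7 / 12 by norm_num,
    show ((1 : ℝ) + 5 / 6) / 2 = 11 / 12 by norm_num]

end

/-! ### The sixteen evaluations -/

theorem mainTheorem9 :
    -- all the series that define the integrands converge (absolutely)
    (∀ t : ℝ, |t| < 1 →
      (Summable (lsTerm2 t) ∧ Summable (lsTerm3 t) ∧ Summable (lsTerm4 t) ∧ Summable (lsTerm6 t)) ∧
      (Summable (lsTildeTerm2 t) ∧ Summable (lsTildeTerm3 t) ∧ Summable (lsTildeTerm4 t) ∧
        Summable (lsTildeTerm6 t))) ∧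
    -- (a), explicit evaluations
    (IntegralEqSeriesEq (fun t => ls2 t / √(1 - t))
        (fun k => 4 * (((2 * k).choose k : ℝ) / 2 ^ (2 * k) *
          ((2 * harm (2 * k) - harm k) / (2 * k + 1))))
        (4 * Real.pi * Real.log 2) ∧
      IntegralEqSeriesEq (fun t => ls3 t / √(1 - t))
        (fun k => 2 * (2 ^ (2 * k) * ((3 * k).choose k : ℝ) / 3 ^ (3 * k) *
          ((3 * harm (3 * k) - harm k) / (2 * k + 1))))
        (9 * (2 - Real.log 3)) ∧
      IntegralEqSeriesEq (fun t => ls4 t / √(1 - t))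
        (fun k => 4 * (((4 * k).choose (2 * k) : ℝ) / 2 ^ (4 * k) *
          ((2 * harm (4 * k) - harm (2 * k)) / (2 * k + 1))))
        (4 * √2 * (2 - Real.log 2)) ∧
      IntegralEqSeriesEq (fun t => ls6 t / √(1 - t))
        (fun k => 2 * (((3 * k).choose k : ℝ) * ((6 * k).choose (3 * k) : ℝ) /
            ((2 ^ 2 * 3 ^ 3) ^ k * ((2 * k).choose k : ℝ)) *
          ((6 * harm (6 * k) - 3 * harm (3 * k) - 2 * harm (2 * k) + harm k) / (2 * k + 1))))
        (3 * √3 / 2 * (3 + Real.log (2 ^ 4 / 3 ^ 3)))) ∧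
    -- (a), general `m`
    (FamilyInRatSpan (fun m t => ls2 t / (1 - t) ^ ((1 : ℝ) / 2 - m))
        (fun m k => 4 * (((2 * k).choose k : ℝ) / 2 ^ (2 * k) *
          ((2 * harm (2 * k) - harm k) * dfRatioA m k)))
        Real.pi (Real.pi * Real.log 2) ∧
      FamilyInRatSpan (fun m t => ls3 t / (1 - t) ^ ((1 : ℝ) / 2 - m))
        (fun m k => 2 * (2 ^ (2 * k) * ((3 * k).choose k : ℝ) / 3 ^ (3 * k) *
          ((3 * harm (3 * k) - harm k) * dfRatioA m k)))
        1 (Real.log 3) ∧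
      FamilyInRatSpan (fun m t => ls4 t / (1 - t) ^ ((1 : ℝ) / 2 - m))
        (fun m k => 4 * (((4 * k).choose (2 * k) : ℝ) / 2 ^ (4 * k) *
          ((2 * harm (4 * k) - harm (2 * k)) * dfRatioA m k)))
        (√2) (√2 * Real.log 2) ∧
      FamilyInRatSpan (fun m t => ls6 t / (1 - t) ^ ((1 : ℝ) / 2 - m))
        (fun m k => 2 * (((6 * k).choose (3 * k) : ℝ) * ((3 * k).choose k : ℝ) /
            ((2 ^ 2 * 3 ^ 3) ^ k * ((2 * k).choose k : ℝ)) *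
          ((6 * harm (6 * k) - 3 * harm (3 * k) - 2 * harm (2 * k) + harm k) * dfRatioA m k)))
        (√3) (√3 * Real.log (2 ^ 4 / 3 ^ 3))) ∧
    -- (b), explicit evaluations
    (IntegralEqSeriesEq (fun t => (ls2 t + lsTilde2 t) / (Real.pi * √(t * (1 - t))))
        (fun k => ((2 * k).choose k : ℝ) ^ 3 / 2 ^ (6 * k) * (4 * harm (2 * k) - 3 * harm k))
        (Real.Gamma (1 / 4) ^ 4 / (2 * Real.pi ^ 3) * Real.log 2) ∧
      IntegralEqSeriesEq (fun t => (ls3 t + lsTilde3 t) / (Real.pi * √(t * (1 - t))))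
        (fun k => ((2 * k).choose k : ℝ) ^ 2 * ((3 * k).choose k : ℝ) /
            (2 ^ (2 * k) * 3 ^ (3 * k)) * (3 * harm (3 * k) - 2 * harm k))
        (9 * (2 : ℝ) ^ ((1 : ℝ) / 3) * Real.Gamma (1 / 3) ^ 6 / (16 * Real.pi ^ 4) *
          Real.log 2) ∧
      IntegralEqSeriesEq (fun t => (ls4 t + lsTilde4 t) / (Real.pi * √(t * (1 - t))))
        (fun k => ((2 * k).choose k : ℝ) ^ 2 * ((4 * k).choose (2 * k) : ℝ) / 2 ^ (8 * k) *
          (4 * harm (4 * k) - 2 * harm (2 * k) - harm k))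
        (2 * Real.pi * Real.log 2 / (Real.Gamma (5 / 8) * Real.Gamma (7 / 8)) ^ 2) ∧
      IntegralEqSeriesEq (fun t => (ls6 t + lsTilde6 t) / (Real.pi * √(t * (1 - t))))
        (fun k => ((2 * k).choose k : ℝ) * ((3 * k).choose k : ℝ) * ((6 * k).choose (3 * k) : ℝ) /
            (2 ^ (6 * k) * 3 ^ (3 * k)) *
          (6 * harm (6 * k) - 3 * harm (3 * k) - 2 * harm (2 * k)))
        (2 * Real.pi * Real.log 2 / (Real.Gamma (7 / 12) * Real.Gamma (11 / 12)) ^ 2)) ∧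
    -- (b), general `m`
    (FamilyInRatSpan
        (fun m t => (ls2 t + lsTilde2 t) / (Real.pi * (t * (1 - t)) ^ ((1 : ℝ) / 2 - m)))
        (fun m k => ((2 * k).choose k : ℝ) ^ 3 / 2 ^ (6 * k + 3 * m) *
          ((4 * harm (2 * k) - 3 * harm k) * dfRatioB m k))
        (Real.Gamma (1 / 4) ^ 4 / Real.pi ^ 3)
        (Real.Gamma (1 / 4) ^ 4 / Real.pi ^ 3 * Real.log 2) ∧
      FamilyInRatSpan
        (fun m t => (ls3 t + lsTilde3 t) / (Real.pi * (t * (1 - t)) ^ ((1 : ℝ) / 2 - m)))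
        (fun m k => ((2 * k).choose k : ℝ) ^ 2 * ((3 * k).choose k : ℝ) /
            (2 ^ (2 * k + 3 * m) * 3 ^ (3 * k)) *
          ((3 * harm (3 * k) - 2 * harm k) * dfRatioB m k))
        ((2 : ℝ) ^ ((1 : ℝ) / 3) * Real.Gamma (1 / 3) ^ 6 / Real.pi ^ 4)
        ((2 : ℝ) ^ ((1 : ℝ) / 3) * Real.Gamma (1 / 3) ^ 6 / Real.pi ^ 4 * Real.log 2) ∧
      FamilyInRatSpan
        (fun m t => (ls4 t + lsTilde4 t) / (Real.pi * (t * (1 - t)) ^ ((1 : ℝ) / 2 - m)))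
        (fun m k => ((2 * k).choose k : ℝ) ^ 2 * ((4 * k).choose (2 * k) : ℝ) /
            2 ^ (8 * k + 3 * m) *
          ((4 * harm (4 * k) - 2 * harm (2 * k) - harm k) * dfRatioB m k))
        (Real.pi / (Real.Gamma (5 / 8) * Real.Gamma (7 / 8)) ^ 2)
        (Real.pi * Real.log 2 / (Real.Gamma (5 / 8) * Real.Gamma (7 / 8)) ^ 2) ∧
      FamilyInRatSpan
        (fun m t => (ls6 t + lsTilde6 t) / (Real.pi * (t * (1 - t)) ^ ((1 : ℝ) / 2 - m)))
        (fun m k => ((2 * k).choose k : ℝ) * ((3 * k).choose k : ℝ) *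
            ((6 * k).choose (3 * k) : ℝ) / (2 ^ (6 * k + 3 * m) * 3 ^ (3 * k)) *
          ((6 * harm (6 * k) - 3 * harm (3 * k) - 2 * harm (2 * k)) * dfRatioB m k))
        (Real.pi / (Real.Gamma (7 / 12) * Real.Gamma (11 / 12)) ^ 2)
        (Real.pi * Real.log 2 / (Real.Gamma (7 / 12) * Real.Gamma (11 / 12)) ^ 2)) := by
  refine ⟨fun t ht => ⟨⟨(ls2_add ht).1.1, (ls3_add ht).1.1, (ls4_add ht).1.1, (ls6_add ht).1.1⟩,
    (ls2_add ht).1.2, (ls3_add ht).1.2, (ls4_add ht).1.2, (ls6_add ht).1.2⟩,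
    ⟨?_, ?_, ?_, ?_⟩, ⟨?_, ?_, ?_, ?_⟩, ⟨?_, ?_, ?_, ?_⟩, ⟨?_, ?_, ?_, ?_⟩⟩
  · refine IntegralEqSeriesEq.explicit_A ls2_family_A (fun k => ?_) ?_
    · rw [dfRatioA_zero]
      ring
    · rw [gammaFactorA_half, digammaTermA_half]
      ring
  · refine IntegralEqSeriesEq.explicit_A ls3_family_A (fun k => ?_) ?_
    · rw [dfRatioA_zero]
      ring
    · rw [gammaFactorA_third, digammaTermA_third]
      ring
  · refine IntegralEqSeriesEq.explicit_A ls4_family_A (fun k => ?_) ?_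
    · rw [dfRatioA_zero]
      ring
    · rw [gammaFactorA_quarter, digammaTermA_quarter]
      ring
  · refine IntegralEqSeriesEq.explicit_A ls6_family_A (fun k => ?_) ?_
    · rw [dfRatioA_zero]
      ring
    · rw [gammaFactorA_sixth, digammaTermA_sixth]
  -- The three rationals express the Gamma factor as s · x, and its product with the digamma term at
  -- m = 0 as r₀ · x + r₁ · y.
  · refine FamilyInRatSpan.of_product (computableRatSeq_ratioA (by norm_num) (by norm_num))
      (computableRatSeq_shiftA (by norm_num) (by norm_num)) (1) (0) (4) ?_ ?_ ls2_family_A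
    · rw [gammaFactorA_half]
      push_cast
      ring
    · rw [gammaFactorA_half, digammaTermA_half]
      push_cast
      ring
  · refine FamilyInRatSpan.of_product (computableRatSeq_ratioA (by norm_num) (by norm_num))
      (computableRatSeq_shiftA (by norm_num) (by norm_num)) (3) (18) (-9) ?_ ?_ ls3_family_A
    · rw [gammaFactorA_third]
      push_cast
      ring
    · rw [gammaFactorA_third, digammaTermA_third]
      push_cast
      ring
  · refine FamilyInRatSpan.of_product (computableRatSeq_ratioA (by norm_num) (by norm_num))
      (computableRatSeq_shiftA (by norm_num) (by norm_num)) (2) (8) (-4) ?_ ?_ ls4_family_A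
    · rw [gammaFactorA_quarter]
      push_cast
      ring
    · rw [gammaFactorA_quarter, digammaTermA_quarter]
      push_cast
      ring
  · refine FamilyInRatSpan.of_product (computableRatSeq_ratioA (by norm_num) (by norm_num))
      (computableRatSeq_shiftA (by norm_num) (by norm_num)) (3 / 2) (9 / 2) (3 / 2) ?_ ?_ ls6_family_A
    · rw [gammaFactorA_sixth]
      push_cast
      ring
    · rw [gammaFactorA_sixth, digammaTermA_sixth]
      push_cast
      ring
  · refine IntegralEqSeriesEq.explicit_B (S := fun t => ls2 t + lsTilde2 t) ls2_family_B
      (fun k => ?_) ?_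
    · rw [dfRatioB_zero, mul_one, mul_zero, add_zero]
    · rw [gammaFactorB_half]
      ring
  · refine IntegralEqSeriesEq.explicit_B (S := fun t => ls3 t + lsTilde3 t) ls3_family_B
      (fun k => ?_) ?_
    · rw [dfRatioB_zero, mul_one, mul_zero, add_zero]
    · rw [gammaFactorB_third]
      ring
  · refine IntegralEqSeriesEq.explicit_B (S := fun t => ls4 t + lsTilde4 t) ls4_family_B
      (fun k => ?_) ?_
    · rw [dfRatioB_zero, mul_one, mul_zero, add_zero]
    · rw [gammaFactorB_quarter]
      ring
  · refine IntegralEqSeriesEq.explicit_B (S := fun t => ls6 t + lsTilde6 t) ls6_family_B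
      (fun k => ?_) ?_
    · rw [dfRatioB_zero, mul_one, mul_zero, add_zero]
    · rw [gammaFactorB_sixth]
      ring
  -- In (b) the term at m = 0 is 2 log 2, so r₀ = 0 and r₁ = 2s.
  · refine FamilyInRatSpan.of_product (computableRatSeq_ratioB (by norm_num) (by norm_num))
      (computableRatSeq_shiftB (by norm_num) (by norm_num)) (1 / 4) 0 (1 / 2) ?_ ?_ ls2_family_B
    · rw [gammaFactorB_half]
      push_cast
      ring
    · rw [gammaFactorB_half]
      push_cast
      ring
  · refine FamilyInRatSpan.of_product (computableRatSeq_ratioB (by norm_num) (by norm_num))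
      (computableRatSeq_shiftB (by norm_num) (by norm_num)) (9 / 32) 0 (9 / 16) ?_ ?_ ls3_family_B
    · rw [gammaFactorB_third]
      push_cast
      ring
    · rw [gammaFactorB_third]
      push_cast
      ring
  · refine FamilyInRatSpan.of_product (computableRatSeq_ratioB (by norm_num) (by norm_num))
      (computableRatSeq_shiftB (by norm_num) (by norm_num)) (1) 0 (2) ?_ ?_ ls4_family_B
    · rw [gammaFactorB_quarter]
      push_cast
      ring
    · rw [gammaFactorB_quarter]
      push_cast
      ring
  · refine FamilyInRatSpan.of_product (computableRatSeq_ratioB (by norm_num) (by norm_num))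
      (computableRatSeq_shiftB (by norm_num) (by norm_num)) (1) 0 (2) ?_ ?_ ls6_family_B
    · rw [gammaFactorB_sixth]
      push_cast
      ring
    · rw [gammaFactorB_sixth]
      push_cast
      ring
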